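/- Let $\mathcal X,\mathcal Y,\hat{\mathcal X},\hat{\mathcal Y}$ be finite alphabets, $q_{XY}$ a pmf on $\mathcal X\times\mathcal Y$, and $\delta_1:\mathcal X\times\hat{\mathcal X}\to[0,\infty)$, $\delta_2:\mathcal Y\times\hat{\mathcal Y}\to[0,\infty)$ distortion measures that are normal: for every $x$ there is $\hat x$ with $\delta_1(x,\hat x)=0$, and for every $y$ there is $\hat y$ with $\delta_2(y,\hat y)=0$. All logarithms are to base 2. *Rate-distortion function.* Let $(\mathbf X,\mathbf Y)=(X_1,Y_1),\dots,(X_n,Y_n)$ be i.i.d. with pmf $q_{XY}$. A code of length $n$ consists of a finite message set $\mathcal M$, an encoder $f:\mathcal X^n\times\mathcal Y^n\to\mathcal M$ and decoders $g_1:\mathcal M\times\mathcal Y^n\to\hat{\mathcal X}^n$, $g_2:\mathcal M\times\mathcal X^n\to\hat{\mathcal Y}^n$. Its rate is $\frac1n\log_2|\mathcal M|$. With $M=f(\mathbf X,\mathbf Y)$, $\hat{\mathbf X}=g_1(M,\mathbf Y)$ and $\hat{\mathbf Y}=g_2(M,\mathbf X)$, its distortions are $\Delta_1=\mathbb E[\frac1n\sum_i\delta_1(X_i,\hat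 X_i)]$ and $\Delta_2=\mathbb E[\frac1n\sum_i\delta_2(Y_i,\hat Y_i)]$. A rate $r\ge 0$ is $(d_1,d_2)$-achievable if for every $\epsilon>0$ there are codes of arbitrarily large length with rate at most $r+\epsilon$ and $\Delta_i\le d_i+\epsilon$ for $i=1,2$. Let $R(d_1,d_2)$ be the infimum of the $(d_1,d_2)$-achievable rates. *Bounds.* Let $R_{X|Y}(d_1)$ be the infimum of $I(X;\hat X|Y)$ over channels $p_{\hat X|XY}$ with $\mathbb E\,\delta_1(X,\hat X)\le d_1$. Let $R^{WZ}_{X|Y}(d_1)$ be the infimum of $I(X;A|Y)$ over joint pmfs $p_{AXY}$ with $|\mathcal A|\le|\mathcal X|+1$ and $(X,Y)$-marginal $q_{XY}$, such that $A - X - Y$ is a Markov chain and some $\pi_1:\mathcal A\times\mathcal Y\to\hat{\mathcal X}$ satisfies $\mathbb E\,\delta_1(X,\pi_1(A,Y))\le d_1$. Define $R_{Y|X}(d_2)$ and $R^{WZ}_{Y|X}(d_2)$ by exchanging the roles of $X$ and $Y$ and using $\delta_2$. Put $$R_L(d_1,d_2)=\max\{R_{X|Y}(d_1),R_{Y|X}(d_2)\},\qquad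 R_U(d_1,d_2)=\max\{R^{WZ}_{X|Y}(d_1),R^{WZ}_{Y|X}(d_2)\}$$ (the cut-set bound and the compress-linear bound). *Minimax capacities.* $\delta_1$ is a difference distortion measure if $\hat{\mathcal X}=\mathcal X=\{0,\dots,l_x-1\}$ and $\delta_1(x,\hat x)=\rho_1(x-\hat x)$ with subtraction modulo $l_x$; similarly $\delta_2(y,\hat y)=\rho_2(y-\hat y)$ modulo $l_y$. For such measures let $$C_{\mathcal X}(d_1)=\inf_{N:\ \mathbb E\,\rho_1(-N)\le d_1}\ \ \sup_{W:\ \mathbb E\,\rho_1(W)\le d_1} I(W;W\oplus N),$$ where $N$ and $W$ are independent with values in $\{0,\dots,l_x-1\}$ and $\oplus$ and $-$ are modulo $l_x$. Define $C_{\mathcal Y}(d_2)$ in the same way from $\rho_2$ and $l_y$. **Theorem.** For all $d_1,d_2\ge 0$, $$R_L(d_1,d_2)\le R(d_1,d_2)\le R_U(d_1,d_2).$$ If $\delta_1$ and $\delta_2$ are difference distortion measures, then $$R_U(d_1,d_2)-R_L(d_1,d_2)\le\max\{C_{\mathcal X}(d_1),C_{\mathcal Y}(d_2)\}.$$ In particular,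 if moreover $\rho_1(-z)=\rho_1(z)$ and $\rho_2(-z)=\rho_2(z)$ for all $z$, this holds with the noise constraints written as $\mathbb E\,\rho_1(N)\le d_1$ and $\mathbb E\,\rho_2(N)\le d_2$. -/

import Mathlib

noncomputable section

namespace RelayRD

/-! ### Information measures of finite joint pmfs, in bits -/

/-- Mutual information `I(U;V)` of a joint pmf `p` on `U × V`. Terms with `p u v = 0` vanish;
if `p u v > 0`, both marginals in the denominator are positive. -/
def mutualInfo {U V : Type*} [Fintype U] [Fintype V] (p : U → V → ℝ) : ℝ :=
  ∑ u, ∑ v, p u v * Real.logb 2 (p u v / ((∑ v', p u v') * (∑ u', p u' v)))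

/-- Conditional mutual information `I(U;V|T)` of a joint pmf `p` on `U × V × T`. -/
def condMutualInfo {U V T : Type*} [Fintype U] [Fintype V] [Fintype T]
    (p : U → V → T → ℝ) : ℝ :=
  ∑ u, ∑ v, ∑ t, p u v t *
    Real.logb 2 ((p u v t * (∑ u', ∑ v', p u' v' t)) / ((∑ v', p u v' t) * (∑ u', p u' v t)))

/-! ### Distortion measures -/

/-- A (nonnegative, real-valued, hence bounded on finite alphabets) per-letter distortion measure
that is normal: every source letter has a reproduction letter with zero distortion. -/
structure IsNormalDistortion {X Xh : Type*} (δ : X → Xh → ℝ) : Prop where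
  nonneg : ∀ x xh, 0 ≤ δ x xh
  normal : ∀ x, ∃ xh, δ x xh = 0

/-- `δ` is the difference distortion measure `ρ (x - xh)`, where source and reproduction alphabet
are both identified with `{0, …, l - 1}` and the subtraction is modulo `l`. -/
def IsDifferenceDistortion {X Xh : Type*} (δ : X → Xh → ℝ) (l : ℕ) (ρ : ZMod l → ℝ) : Prop :=
  ∃ (e : X ≃ ZMod l) (eh : Xh ≃ ZMod l), ∀ x xh, δ x xh = ρ (e x - eh xh)

/-! ### The operational rate-distortion function `R(d₁, d₂)` -/

/-- A blockcode of length `n`: the transmitter sees both sequences; receiver 1 knows the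
`Y`-sequence and reproduces the `X`-sequence, receiver 2 the other way round. -/
structure RDCode (X Y Xh Yh : Type*) (n : ℕ) where
  /-- number of messages -/
  M : ℕ
  enc : (Fin n → X) → (Fin n → Y) → Fin M
  dec₁ : Fin M → (Fin n → Y) → (Fin n → Xh)
  dec₂ : Fin M → (Fin n → X) → (Fin n → Yh)

namespace RDCode

variable {X Y Xh Yh : Type*} {n : ℕ}

/-- Compression rate in bits per source symbol. -/
def rate (c : RDCode X Y Xh Yh n) : ℝ := Real.logb 2 c.M / n

/-- Expected average distortion at receiver 1, for an iid source with letter pmf `q`. -/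
def dist₁ [Fintype X] [Fintype Y] (c : RDCode X Y Xh Yh n) (q : X × Y → ℝ)
    (δ₁ : X → Xh → ℝ) : ℝ :=
  ∑ x : Fin n → X, ∑ y : Fin n → Y, (∏ i, q (x i, y i)) *
    ((1 / (n : ℝ)) * ∑ i, δ₁ (x i) (c.dec₁ (c.enc x y) y i))

/-- Expected average distortion at receiver 2. -/
def dist₂ [Fintype X] [Fintype Y] (c : RDCode X Y Xh Yh n) (q : X × Y → ℝ)
    (δ₂ : Y → Yh → ℝ) : ℝ :=
  ∑ x : Fin n → X, ∑ y : Fin n → Y, (∏ i, q (x i, y i)) *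
    ((1 / (n : ℝ)) * ∑ i, δ₂ (y i) (c.dec₂ (c.enc x y) x i))

end RDCode

/-- The rate `r ≥ 0` is `(d₁, d₂)`-achievable: for every `ε > 0` there are codes of arbitrarily
large block length meeting the rate and both distortion targets up to `ε`. -/
def Achievable {X Y Xh Yh : Type*} [Fintype X] [Fintype Y] (q : X × Y → ℝ)
    (δ₁ : X → Xh → ℝ) (δ₂ : Y → Yh → ℝ) (d₁ d₂ r : ℝ) : Prop :=
  0 ≤ r ∧ ∀ ε : ℝ, 0 < ε → ∀ n₀ : ℕ, ∃ n : ℕ, n₀ < n ∧ ∃ c : RDCode X Y Xh Yh n,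
    c.rate ≤ r + ε ∧ c.dist₁ q δ₁ ≤ d₁ + ε ∧ c.dist₂ q δ₂ ≤ d₂ + ε

/-- The rate-distortion function `R(d₁, d₂)` (no common reconstructions). -/
def rdFunction {X Y Xh Yh : Type*} [Fintype X] [Fintype Y] (q : X × Y → ℝ)
    (δ₁ : X → Xh → ℝ) (δ₂ : Y → Yh → ℝ) (d₁ d₂ : ℝ) : ℝ :=
  sInf {r : ℝ | Achievable q δ₁ δ₂ d₁ d₂ r}

/-! ### Conditional and Wyner-Ziv rate-distortion functions, and the two bounds -/

/-- Conditional rate-distortion function `R_{X|Y}(d)`: the least `I(X;X̂|Y)` over all channels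
`W (x, y) xh` from `X × Y` to `Xh` with expected distortion at most `d`. -/
def condRD {X Y Xh : Type*} [Fintype X] [Fintype Y] [Fintype Xh] (q : X × Y → ℝ)
    (δ : X → Xh → ℝ) (d : ℝ) : ℝ :=
  sInf {r : ℝ | ∃ W : X × Y → Xh → ℝ, (∀ s, W s ∈ stdSimplex ℝ Xh) ∧
    ∑ x, ∑ y, ∑ xh, W (x, y) xh * q (x, y) * δ x xh ≤ d ∧
    r = condMutualInfo (fun x xh y => W (x, y) xh * q (x, y))}

/-- Wyner-Ziv rate-distortion function `R^WZ_{X|Y}(d)`: the least `I(X;A|Y)` over all joint pmfs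
`p` of `(A, X, Y)`, with `A` of cardinality at most `|X| + 1`, whose `(X, Y)`-marginal is `q`,
which form a Markov chain `A - X - Y`, and for which some `π(A, Y)` has expected distortion
at most `d`. -/
def wzRD {X Y Xh : Type*} [Fintype X] [Fintype Y] (q : X × Y → ℝ)
    (δ : X → Xh → ℝ) (d : ℝ) : ℝ :=
  sInf {r : ℝ | ∃ k : ℕ, k ≤ Fintype.card X + 1 ∧ ∃ p : Fin k → X → Y → ℝ,
    (∀ a x y, 0 ≤ p a x y) ∧
    (∀ x y, ∑ a, p a x y = q (x, y)) ∧
    (∀ a x y, p a x y * (∑ a', ∑ y', p a' x y') = (∑ y', p a x y') * (∑ a', p a' x y)) ∧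
    (∃ π : Fin k → Y → Xh, ∑ a, ∑ x, ∑ y, p a x y * δ x (π a y) ≤ d) ∧
    r = condMutualInfo (fun x a y => p a x y)}

/-- The cut-set bound `R_L(d₁, d₂) = max {R_{X|Y}(d₁), R_{Y|X}(d₂)}`. -/
def cutSetBound {X Y Xh Yh : Type*} [Fintype X] [Fintype Y] [Fintype Xh] [Fintype Yh]
    (q : X × Y → ℝ) (δ₁ : X → Xh → ℝ) (δ₂ : Y → Yh → ℝ) (d₁ d₂ : ℝ) : ℝ :=
  max (condRD q δ₁ d₁) (condRD (q ∘ Prod.swap) δ₂ d₂)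

/-- The compress-linear bound `R_U(d₁, d₂) = max {R^WZ_{X|Y}(d₁), R^WZ_{Y|X}(d₂)}`. -/
def compressLinearBound {X Y Xh Yh : Type*} [Fintype X] [Fintype Y]
    (q : X × Y → ℝ) (δ₁ : X → Xh → ℝ) (δ₂ : Y → Yh → ℝ) (d₁ d₂ : ℝ) : ℝ :=
  max (wzRD q δ₁ d₁) (wzRD (q ∘ Prod.swap) δ₂ d₂)

/-! ### Minimax capacity -/

/-- Capacity of the additive channel `w ↦ w + N` modulo `l`, where `N` has pmf `pN`, under the
input constraint `E[ρ(W)] ≤ d`. The joint pmf of `(W, W + N)` is `pW w * pN (z - w)`. -/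
def addCapacity {l : ℕ} [NeZero l] (ρ : ZMod l → ℝ) (d : ℝ) (pN : ZMod l → ℝ) : ℝ :=
  sSup {r : ℝ | ∃ pW ∈ stdSimplex ℝ (ZMod l), ∑ w, pW w * ρ w ≤ d ∧
    r = mutualInfo (fun w z => pW w * pN (z - w))}

/-- Minimax (worst noise) capacity: the infimum of `addCapacity ρ d pN` over all noise pmfs with
`E[σ(N)] ≤ d`. The input is constrained by `ρ` and the noise by `σ`. -/
def minimaxCapacity {l : ℕ} [NeZero l] (ρ σ : ZMod l → ℝ) (d : ℝ) : ℝ :=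
  sInf {c : ℝ | ∃ pN ∈ stdSimplex ℝ (ZMod l), ∑ z, pN z * σ z ≤ d ∧ c = addCapacity ρ d pN}

end RelayRD

end

noncomputable section

namespace RelayRD

open Finset

/-! ### Gibbs' inequality and conditional mutual information -/

/-! Lower bound. Look at one receiver at a time. The letters of a code at a uniformly random time
form a single-letter pmf with the right marginal and distortion, whose conditional mutual
information is at most the rate (`exists_pmf_of_code`). Instead of a chain of entropy identities, a
single application of Gibbs' inequality `sum_mul_logb_nonneg` on blocks gives this. The slack `ε` in
achievability is removed by compactness of the set of channels (`condRD_le_of_forall_pos`).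

Upper bound. Take a Wyner-Ziv code for `X` given `Y` and one for `Y` given `X`, both with `M`
messages, and send the sum of the two messages modulo `M`. Each receiver computes the message meant
for the other one from its own side information and subtracts it, so the cost is the maximum of the
two rates and not their sum (`achievable_compressLinearBound`). The Wyner-Ziv codes come from a
one-shot random coding bound (`oneshot_wynerZiv`): soft covering replaces the source by the output
of a random codebook, and a likelihood threshold lets the decoder find the codeword inside its bin.
Applied to blocks, with information densities concentrating by Chebyshev, it reaches the rate
`I(X;A) - I(Y;A)`, which equals `I(X;A|Y)` by the Markov property.

Gap. For difference distortions, test the Wyner-Ziv problem with `A = X + N`, reproducing `X` by `A`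
itself. Against any channel to `X̂`, its rate exceeds `I(X;X̂|Y)` by at most `I(W;W+N)` with `W = X
- X̂` (`condMutualInfo_add_noise_le`). The distortion constraint on `X̂` is the input constraint on
`W`, and that on `A` is the constraint on `-N`. This bounds each rate loss by a minimax capacity. -/

theorem sum_mul_logb_nonneg {S : Type*} [Fintype S] (P t : S → ℝ) (hP : ∀ s, 0 ≤ P s)
    (ht : ∀ s, 0 < P s → 0 < t s) (hsum : ∑ s, P s / t s ≤ ∑ s, P s) :
    0 ≤ ∑ s, P s * Real.logb 2 (t s) := by
  have hlog : 0 < Real.log 2 := Real.log_pos one_lt_two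
  -- Pointwise form of `1 - 1/t ≤ log t`, weighted by `P`; atoms of weight zero need no information
  -- on `t`.
  have key : ∀ s, (P s - P s / t s) / Real.log 2 ≤ P s * Real.logb 2 (t s) := by
    intro s
    rcases (hP s).eq_or_lt with h | h
    · simp [← h]
    · have h1 := Real.one_sub_inv_le_log_of_pos (ht s h)
      rw [Real.logb, ← mul_div_assoc]
      gcongr
      calc P s - P s / t s = P s * (1 - (t s)⁻¹) := by ring
        _ ≤ _ := by gcongr
  calc 0 ≤ (∑ s, P s - ∑ s, P s / t s) / Real.log 2 := div_nonneg (by linarith) hlog.le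
    _ = ∑ s, (P s - P s / t s) / Real.log 2 := by rw [← sum_div, sum_sub_distrib]
    _ ≤ _ := sum_le_sum fun s _ => key s

theorem condMutualInfo_eq_sum_prod {U V T : Type*} [Fintype U] [Fintype V] [Fintype T]
    (p : U → V → T → ℝ) :
    condMutualInfo p = ∑ s : U × V × T, p s.1 s.2.1 s.2.2 *
      Real.logb 2 ((p s.1 s.2.1 s.2.2 * (∑ u', ∑ v', p u' v' s.2.2)) /
        ((∑ v', p s.1 v' s.2.2) * (∑ u', p u' s.2.1 s.2.2))) := by
  simp only [condMutualInfo, Fintype.sum_prod_type]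

section Marginals

theorem marginal_pos_right {U V T : Type*} [Fintype V] {p : U → V → T → ℝ}
    (hp : ∀ u v t, 0 ≤ p u v t) {u : U} {v : V} {t : T} (h : 0 < p u v t) :
    0 < ∑ v', p u v' t :=
  sum_pos' (fun _ _ => hp _ _ _) ⟨v, mem_univ _, h⟩

theorem marginal_pos_left {U V T : Type*} [Fintype U] {p : U → V → T → ℝ}
    (hp : ∀ u v t, 0 ≤ p u v t) {u : U} {v : V} {t : T} (h : 0 < p u v t) :
    0 < ∑ u', p u' v t :=
  sum_pos' (fun _ _ => hp _ _ _) ⟨u, mem_univ _, h⟩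

theorem marginal_pos_both {U V T : Type*} [Fintype U] [Fintype V] {p : U → V → T → ℝ}
    (hp : ∀ u v t, 0 ≤ p u v t) {u : U} {v : V} {t : T} (h : 0 < p u v t) :
    0 < ∑ u', ∑ v', p u' v' t :=
  sum_pos' (fun _ _ => sum_nonneg fun _ _ => hp _ _ _)
    ⟨u, mem_univ _, marginal_pos_right hp h⟩

variable {U V T : Type*} [Fintype U] [Fintype V] [Fintype T] {p : U → V → T → ℝ}

/-- Gibbs' inequality for the density ratio. It also supplies the lower bound 0 that makes the
infima in `condRD` and `wzRD` usable. No normalization of `p` is needed. -/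
theorem condMutualInfo_nonneg (hp : ∀ u v t, 0 ≤ p u v t) : 0 ≤ condMutualInfo p := by
  rw [condMutualInfo_eq_sum_prod]
  refine sum_mul_logb_nonneg (fun s : U × V × T => p s.1 s.2.1 s.2.2) _ (fun s => hp _ _ _)
    (fun s h => ?_) ?_
  · have h1 := marginal_pos_right hp h
    have h2 := marginal_pos_left hp h
    have h3 := marginal_pos_both hp h
    have h0 : 0 < p s.1 s.2.1 s.2.2 := h
    positivity
  · calc _ ≤ ∑ s : U × V × T, ((∑ v', p s.1 v' s.2.2) * (∑ u', p u' s.2.1 s.2.2)) /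
            (∑ u', ∑ v', p u' v' s.2.2) := by
          refine sum_le_sum fun s _ => ?_
          rcases (hp s.1 s.2.1 s.2.2).eq_or_lt with h | h
          · rw [← h, zero_div]
            exact div_nonneg (mul_nonneg (sum_nonneg fun _ _ => hp _ _ _)
              (sum_nonneg fun _ _ => hp _ _ _))
              (sum_nonneg fun _ _ => sum_nonneg fun _ _ => hp _ _ _)
          · have h1 := marginal_pos_right hp h
            have h2 := marginal_pos_left hp h
            have h3 := marginal_pos_both hp h
            apply le_of_eq
            field_simp
      _ = ∑ t, (∑ u, ∑ v', p u v' t) * (∑ v, ∑ u', p u' v t) / (∑ u', ∑ v', p u' v' t) := by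
          simp only [Fintype.sum_prod_type]
          rw [sum_congr rfl fun u _ => sum_comm, sum_comm]
          refine sum_congr rfl fun t _ => ?_
          simp only [← sum_div, sum_mul_sum]
      _ = ∑ t, ∑ u, ∑ v, p u v t := by
          refine sum_congr rfl fun t _ => ?_
          rw [sum_comm (f := fun v u' => p u' v t), mul_self_div_self]
      _ = _ := by
          simp only [Fintype.sum_prod_type]
          rw [sum_comm]
          exact sum_congr rfl fun u _ => sum_comm

/-- The entropy form `H(U,T) + H(V,T) - H(U,V,T) - H(T)`. Since `Real.negMulLog` is continuous at 0,
continuity in `p` becomes evident, which the quotient form hides. -/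
theorem condMutualInfo_eq_negMulLog (hp : ∀ u v t, 0 ≤ p u v t) :
    condMutualInfo p = ((∑ u, ∑ t, Real.negMulLog (∑ v, p u v t))
      + (∑ v, ∑ t, Real.negMulLog (∑ u, p u v t))
      - (∑ u, ∑ v, ∑ t, Real.negMulLog (p u v t))
      - ∑ t, Real.negMulLog (∑ u, ∑ v, p u v t)) / Real.log 2 := by
  have key : ∀ u v t, p u v t * Real.logb 2 ((p u v t * (∑ u', ∑ v', p u' v' t)) /
      ((∑ v', p u v' t) * (∑ u', p u' v t))) =
      (- (p u v t * Real.log (∑ v', p u v' t)) - (p u v t * Real.log (∑ u', p u' v t))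
        + (p u v t * Real.log (p u v t)) + p u v t * Real.log (∑ u', ∑ v', p u' v' t))
        / Real.log 2 := by
    intro u v t
    rcases (hp u v t).eq_or_lt with h | h
    · simp [← h]
    · have h1 := marginal_pos_right hp h
      have h2 := marginal_pos_left hp h
      have h3 := marginal_pos_both hp h
      rw [Real.logb, Real.log_div (by positivity) (by positivity), Real.log_mul h.ne' h3.ne',
        Real.log_mul h1.ne' h2.ne']
      ring
  simp only [condMutualInfo, key, ← sum_div]
  congr 1
  simp only [sum_add_distrib, sum_sub_distrib, sum_neg_distrib, Real.negMulLog, neg_mul]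
  have e1 : ∑ u, ∑ v, ∑ t, p u v t * Real.log (∑ v', p u v' t) =
      ∑ u, ∑ t, (∑ v', p u v' t) * Real.log (∑ v', p u v' t) := by
    refine sum_congr rfl fun u _ => ?_
    rw [sum_comm]
    simp only [sum_mul]
  have e2 : ∑ u, ∑ v, ∑ t, p u v t * Real.log (∑ u', p u' v t) =
      ∑ v, ∑ t, (∑ u', p u' v t) * Real.log (∑ u', p u' v t) := by
    rw [sum_comm]
    refine sum_congr rfl fun v _ => ?_
    rw [sum_comm]
    simp only [sum_mul]
  have e3 : ∑ u, ∑ v, ∑ t, p u v t * Real.log (∑ u', ∑ v', p u' v' t) =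
      ∑ t, (∑ u', ∑ v', p u' v' t) * Real.log (∑ u', ∑ v', p u' v' t) := by
    rw [sum_congr rfl fun u _ => sum_comm, sum_comm]
    refine sum_congr rfl fun t _ => ?_
    simp only [sum_mul]
  rw [e1, e2, e3]
  ring

end Marginals

/-! ### Expectations under iid weights -/

section IID

variable {ι S : Type*} [Fintype ι] [Fintype S] [DecidableEq ι] {p : S → ℝ}

theorem sum_prod_apply (f : ι → S → ℝ) : ∑ c : ι → S, ∏ i, f i (c i) = ∏ i, ∑ s, f i s := by
  rw [prod_univ_sum, Fintype.piFinset_univ]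

theorem sum_iid (hp : ∑ s, p s = 1) : ∑ c : ι → S, ∏ i, p (c i) = 1 := by
  rw [sum_prod_apply fun _ => p]; simp [hp]

theorem sum_iid_mul (hp : ∑ s, p s = 1) (j : ι) (u : S → ℝ) :
    ∑ c : ι → S, (∏ i, p (c i)) * u (c j) = ∑ s, p s * u s := by
  -- Writing `u (c j)` as a product over all coordinates lets the sum over sequences factor; every
  -- factor with `i ≠ j` is 1.
  have h : ∀ c : ι → S, (∏ i, p (c i)) * u (c j) =
      ∏ i, (p (c i) * if i = j then u (c i) else 1) := by
    intro c
    rw [prod_mul_distrib]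
    simp
  simp only [h]
  rw [sum_prod_apply fun i s => p s * if i = j then u s else 1,
    Fintype.prod_eq_single j fun i hi => by simp [hi, hp]]
  simp

theorem sum_iid_mul_mul (hp : ∑ s, p s = 1) {j k : ι} (hjk : j ≠ k) (u v : S → ℝ) :
    ∑ c : ι → S, (∏ i, p (c i)) * (u (c j) * v (c k)) =
      (∑ s, p s * u s) * ∑ s, p s * v s := by
  have h : ∀ c : ι → S, (∏ i, p (c i)) * (u (c j) * v (c k)) =
      ∏ i, (p (c i) * ((if i = j then u (c i) else 1) * if i = k then v (c i) else 1)) := by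
    intro c
    rw [prod_mul_distrib, prod_mul_distrib]
    simp
  simp only [h]
  rw [sum_prod_apply fun i s => p s * ((if i = j then u s else 1) * if i = k then v s else 1),
    Fintype.prod_eq_mul j k hjk fun i hi => by simp [hi.1, hi.2, hp]]
  simp [hjk, hjk.symm]

/-- Variances of independent terms add: the cross terms factor into products of means, which vanish.
-/
theorem sum_iid_mul_sq (hp : ∑ s, p s = 1) (g : S → ℝ) (hg : ∑ s, p s * g s = 0) :
    ∑ c : ι → S, (∏ i, p (c i)) * (∑ i, g (c i)) ^ 2 =
      Fintype.card ι * ∑ s, p s * g s ^ 2 := by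
  have h : ∀ c : ι → S, (∏ i, p (c i)) * (∑ i, g (c i)) ^ 2 =
      ∑ j, ∑ k, (∏ i, p (c i)) * (g (c j) * g (c k)) := by
    intro c
    rw [sq, sum_mul_sum, mul_sum]
    simp only [mul_sum]
  simp only [h]
  rw [sum_comm]
  have h2 : ∀ j : ι, ∑ c : ι → S, ∑ k, (∏ i, p (c i)) * (g (c j) * g (c k)) =
      ∑ s, p s * g s ^ 2 := by
    intro j
    rw [sum_comm, Fintype.sum_eq_single j fun k hk => by
      rw [sum_iid_mul_mul hp hk.symm, hg, zero_mul]]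
    rw [sum_iid_mul hp j fun s => g s * g s]
    simp only [sq]
  simp [h2]

/-- Chebyshev's inequality for a sum of iid terms. -/
theorem sum_iid_indicator_le (hp0 : ∀ s, 0 ≤ p s) (hp : ∑ s, p s = 1) (f : S → ℝ) {η : ℝ}
    (hη : 0 < η) {n : ℕ} (hn : 0 < n) (E : (Fin n → S) → Prop)
    [DecidablePred E]
    (hE : ∀ c, E c → (∀ i, 0 < p (c i)) →
      n * η ≤ |∑ i, f (c i) - n * ∑ s, p s * f s|) :
    ∑ c : Fin n → S, (∏ i, p (c i)) * (if E c then 1 else 0) ≤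
      (∑ s, p s * (f s - ∑ s, p s * f s) ^ 2) / (n * η ^ 2) := by
  set μ := ∑ s, p s * f s
  have hn' : (0 : ℝ) < n := by exact_mod_cast hn
  have hmean : ∑ s, p s * (f s - μ) = 0 := by
    simp only [mul_sub, sum_sub_distrib, ← sum_mul, hp]
    simp [μ]
  have key : ∀ c : Fin n → S, (∏ i, p (c i)) * (if E c then 1 else 0) ≤
      (∏ i, p (c i)) * (∑ i, (f (c i) - μ)) ^ 2 / (n * η) ^ 2 := by
    intro c
    have hw : 0 ≤ ∏ i, p (c i) := prod_nonneg fun _ _ => hp0 _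
    by_cases hc : E c
    -- Sequences of weight zero contribute nothing, so the deviation is only required on the
    -- support, where logarithms of probabilities make sense.
    · rcases hw.eq_or_lt with h0 | h0
      · simp [← h0]
      · have hpos : ∀ i, 0 < p (c i) := fun i =>
          (hp0 _).lt_of_ne fun h => h0.ne' (prod_eq_zero (mem_univ i) h.symm)
        have h1 := hE c hc hpos
        rw [if_pos hc, mul_div_assoc]
        gcongr
        rw [one_le_div (by positivity), ← sq_abs (∑ i, (f (c i) - μ))]
        gcongr
        simpa using h1
    · rw [if_neg hc, mul_zero]; positivity
  calc _ ≤ ∑ c : Fin n → S, (∏ i, p (c i)) * (∑ i, (f (c i) - μ)) ^ 2 / (n * η) ^ 2 :=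
        sum_le_sum fun c _ => key c
    _ = _ := by
        rw [← sum_div, sum_iid_mul_sq hp (fun s => f s - μ) hmean, Fintype.card_fin]
        field_simp

end IID

theorem sum_pair_pi {ι A B : Type*} [Fintype ι] [Fintype A] [Fintype B] [DecidableEq ι]
    (F : (ι → A) → (ι → B) → ℝ) :
    ∑ a, ∑ b, F a b = ∑ c : ι → A × B, F (fun i => (c i).1) fun i => (c i).2 := by
  rw [← Fintype.sum_prod_type']
  exact (Fintype.sum_equiv (Equiv.arrowProdEquivProdArrow ι (fun _ => A) (fun _ => B)) _ _
    fun _ => rfl).symm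

/-! ### The cut-set bound -/

theorem condRD_le {X Y Xh : Type*} [Fintype X] [Fintype Y] [Fintype Xh] {q : X × Y → ℝ}
    (hq : ∀ s, 0 ≤ q s) {δ : X → Xh → ℝ} {d : ℝ} (W : X × Y → Xh → ℝ)
    (hW : ∀ s, W s ∈ stdSimplex ℝ Xh)
    (hd : ∑ x, ∑ y, ∑ xh, W (x, y) xh * q (x, y) * δ x xh ≤ d) :
    condRD q δ d ≤ condMutualInfo (fun x xh y => W (x, y) xh * q (x, y)) := by
  refine csInf_le ⟨0, ?_⟩ ⟨W, hW, hd, rfl⟩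
  rintro _ ⟨W', hW', -, rfl⟩
  exact condMutualInfo_nonneg fun _ _ _ => mul_nonneg ((hW' _).1 _) (hq _)

/-- Channels form a compact product of simplices, on which distortion and mutual information are
continuous. A limit point of nearly feasible channels is therefore exactly feasible and has
information at most `r`. -/
theorem condRD_le_of_forall_pos {X Y Xh : Type*} [Fintype X] [Fintype Y] [Fintype Xh]
    {q : X × Y → ℝ} (hq : ∀ s, 0 ≤ q s) {δ : X → Xh → ℝ} {d r : ℝ}
    (h : ∀ ε : ℝ, 0 < ε → ∃ W : X × Y → Xh → ℝ, (∀ s, W s ∈ stdSimplex ℝ Xh) ∧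
      ∑ x, ∑ y, ∑ xh, W (x, y) xh * q (x, y) * δ x xh ≤ d + ε ∧
      condMutualInfo (fun x xh y => W (x, y) xh * q (x, y)) ≤ r + ε) :
    condRD q δ d ≤ r := by
  have hcpt : IsCompact (Set.pi Set.univ fun _ : X × Y => stdSimplex ℝ Xh) :=
    isCompact_univ_pi fun _ => isCompact_stdSimplex ℝ Xh
  let G : (X × Y → Xh → ℝ) → ℝ := fun W =>
    ((∑ x, ∑ y, Real.negMulLog (∑ xh, W (x, y) xh * q (x, y)))
      + (∑ xh, ∑ y, Real.negMulLog (∑ x, W (x, y) xh * q (x, y)))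
      - (∑ x, ∑ xh, ∑ y, Real.negMulLog (W (x, y) xh * q (x, y)))
      - ∑ y, Real.negMulLog (∑ x, ∑ xh, W (x, y) xh * q (x, y))) / Real.log 2
  have hG : ∀ W : X × Y → Xh → ℝ, (∀ s, W s ∈ stdSimplex ℝ Xh) →
      condMutualInfo (fun x xh y => W (x, y) xh * q (x, y)) = G W := fun W hW =>
    condMutualInfo_eq_negMulLog fun _ _ _ => mul_nonneg ((hW _).1 _) (hq _)
  have hGc : Continuous G := by fun_prop
  have hDc : Continuous fun W : X × Y → Xh → ℝ =>
      ∑ x, ∑ y, ∑ xh, W (x, y) xh * q (x, y) * δ x xh := by fun_prop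
  choose W hW hWd hWI using fun k : ℕ => h (1 / ((k : ℝ) + 1)) Nat.one_div_pos_of_nat
  obtain ⟨W₀, hW₀, φ, hφ, hlim⟩ := hcpt.tendsto_subseq (x := W) fun k s _ => hW k s
  have hε : Filter.Tendsto (fun k => 1 / ((φ k : ℝ) + 1)) Filter.atTop (nhds 0) :=
    tendsto_one_div_add_atTop_nhds_zero_nat.comp hφ.tendsto_atTop
  have hW₀' : ∀ s, W₀ s ∈ stdSimplex ℝ Xh := fun s => hW₀ s trivial
  have hd₀ := le_of_tendsto_of_tendsto' ((hDc.tendsto W₀).comp hlim)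
    (hε.const_add d) fun k => hWd (φ k)
  have hI₀ := le_of_tendsto_of_tendsto' ((hGc.tendsto W₀).comp hlim)
    (hε.const_add r) fun k => (hG _ (hW (φ k))).symm.trans_le (hWI (φ k))
  rw [add_zero] at hd₀ hI₀
  exact (condRD_le hq W₀ hW₀' hd₀).trans ((hG _ hW₀').trans_le hI₀)

/-- Every joint pmf with a prescribed marginal comes from a channel. -/
theorem exists_channel {X Y Xh : Type*} [Fintype X] [Fintype Y] [Fintype Xh] [Nonempty Xh]
    {q : X × Y → ℝ} {p : X → Xh → Y → ℝ} (hp : ∀ x xh y, 0 ≤ p x xh y)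
    (hpq : ∀ x y, ∑ xh, p x xh y = q (x, y)) :
    ∃ W : X × Y → Xh → ℝ, (∀ s, W s ∈ stdSimplex ℝ Xh) ∧
      ∀ x xh y, W (x, y) xh * q (x, y) = p x xh y := by
  classical
  obtain ⟨b⟩ := ‹Nonempty Xh›
  -- Where `q` vanishes the conditional law is arbitrary; a point mass at `b` keeps `W` stochastic.
  refine ⟨fun s xh => if q s = 0 then (if xh = b then 1 else 0) else p s.1 xh s.2 / q s,
    ?_, ?_⟩
  · rintro ⟨x, y⟩
    have hq : 0 ≤ q (x, y) := hpq x y ▸ sum_nonneg fun _ _ => hp _ _ _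
    refine ⟨fun xh => ?_, ?_⟩
    · dsimp only
      split_ifs <;> first | exact div_nonneg (hp _ _ _) hq | norm_num
    · by_cases h : q (x, y) = 0
      · simp [h]
      · simp only [h, if_false, ← sum_div, hpq]
        exact div_self h
  · intro x xh y
    by_cases h : q (x, y) = 0
    · rw [h, mul_zero]
      have := hpq x y
      rw [h, sum_eq_zero_iff_of_nonneg fun _ _ => hp _ _ _] at this
      exact (this xh (mem_univ _)).symm
    · simp only [h, if_false]
      exact div_mul_cancel₀ _ h

/-- Single-letterization: a code yields a joint pmf with marginal `q`, the same distortion, and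
conditional mutual information at most the rate. -/
theorem exists_pmf_of_code {X Y Xh : Type*} [Fintype X] [Fintype Y] [Fintype Xh]
    {q : X × Y → ℝ} (hq : q ∈ stdSimplex ℝ (X × Y)) (δ : X → Xh → ℝ) {n : ℕ} (hn : 0 < n)
    {M : ℕ} (enc : (Fin n → X) → (Fin n → Y) → Fin M)
    (dec : Fin M → (Fin n → Y) → Fin n → Xh) :
    ∃ p : X → Xh → Y → ℝ, (∀ x xh y, 0 ≤ p x xh y) ∧ (∀ x y, ∑ xh, p x xh y = q (x, y)) ∧
      ∑ x, ∑ y, ∑ xh, p x xh y * δ x xh =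
        ∑ x : Fin n → X, ∑ y : Fin n → Y, (∏ i, q (x i, y i)) *
          ((1 / (n : ℝ)) * ∑ i, δ (x i) (dec (enc x y) y i)) ∧
      condMutualInfo p ≤ Real.logb 2 M / n := by
  classical
  have hn' : (0 : ℝ) < n := by exact_mod_cast hn
  let Q : (Fin n → X) × (Fin n → Y) → ℝ := fun s => ∏ i, q (s.1 i, s.2 i)
  let h : (Fin n → X) × (Fin n → Y) → Fin n → Xh := fun s => dec (enc s.1 s.2) s.2
  have hQ0 : ∀ s, 0 ≤ Q s := fun s => prod_nonneg fun _ _ => hq.1 _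
  have hQ : ∀ F : Fin n → X → Y → ℝ, ∑ s, Q s * ∑ i, F i (s.1 i) (s.2 i) =
      ∑ i, ∑ x, ∑ y, q (x, y) * F i x y := by
    intro F
    simp only [mul_sum]
    rw [sum_comm]
    refine sum_congr rfl fun i _ => ?_
    rw [Fintype.sum_prod_type, sum_pair_pi fun a b => Q (a, b) * F i (a i) (b i)]
    rw [← Fintype.sum_prod_type' fun x y => q (x, y) * F i x y]
    exact sum_iid_mul hq.2 i fun s : X × Y => F i s.1 s.2
  have hQ1 : ∑ s, Q s = 1 := by
    rw [Fintype.sum_prod_type, sum_pair_pi fun a b => Q (a, b)]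
    exact sum_iid hq.2
  -- The joint law of source letter, reproduction and side information at a uniformly random time.
  let p : X → Xh → Y → ℝ := fun x xh y =>
    (1 / n) * ∑ s, Q s * ∑ i, if s.1 i = x ∧ h s i = xh ∧ s.2 i = y then 1 else 0
  have hp0 : ∀ x xh y, 0 ≤ p x xh y := fun x xh y =>
    mul_nonneg (by positivity) (sum_nonneg fun s _ => mul_nonneg (hQ0 s)
      (sum_nonneg fun i _ => by split_ifs <;> norm_num))
  -- Marginal, distortion and mutual information are all read off from this one formula by a choice
  -- of `F`.
  have hpF : ∀ F : X → Xh → Y → ℝ, ∑ x, ∑ xh, ∑ y, p x xh y * F x xh y =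
      (1 / n) * ∑ s, Q s * ∑ i, F (s.1 i) (h s i) (s.2 i) := by
    intro F
    have e : ∀ x xh y, p x xh y * F x xh y = ∑ s, ∑ i, (1 / n) * (Q s *
        (if s.1 i = x then if h s i = xh then if s.2 i = y then F x xh y else 0 else 0 else 0)) := by
      intro x xh y
      simp only [p, mul_sum, sum_mul, ite_and]
      refine sum_congr rfl fun s _ => sum_congr rfl fun i _ => ?_
      split_ifs <;> ring
    calc _ = ∑ x, ∑ xh, ∑ s, ∑ i, ∑ y, (1 / n) * (Q s * (if s.1 i = x then if h s i = xh then
              if s.2 i = y then F x xh y else 0 else 0 else 0)) := by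
          simp only [e]
          refine sum_congr rfl fun x _ => sum_congr rfl fun xh _ => ?_
          rw [sum_comm]
          exact sum_congr rfl fun s _ => sum_comm
      _ = ∑ x, ∑ s, ∑ i, ∑ xh, ∑ y, (1 / n) * (Q s * (if s.1 i = x then if h s i = xh then
              if s.2 i = y then F x xh y else 0 else 0 else 0)) := by
          refine sum_congr rfl fun x _ => ?_
          rw [sum_comm]
          exact sum_congr rfl fun s _ => sum_comm
      _ = ∑ s, ∑ i, ∑ x, ∑ xh, ∑ y, (1 / n) * (Q s * (if s.1 i = x then if h s i = xh then
              if s.2 i = y then F x xh y else 0 else 0 else 0)) := by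
          rw [sum_comm]
          exact sum_congr rfl fun s _ => sum_comm
      _ = _ := by
          simp only [← mul_sum, sum_ite_irrel, sum_const_zero, sum_ite_eq, mem_univ, if_true]
  have hpq : ∀ x y, ∑ xh, p x xh y = q (x, y) := by
    intro x y
    have h1 := hpF fun x' _ y' => if x' = x then if y' = y then 1 else 0 else 0
    rw [hQ fun _ x' y' => if x' = x then if y' = y then 1 else 0 else 0] at h1
    simp only [mul_ite, mul_one, mul_zero, sum_ite_irrel, sum_const_zero, sum_ite_eq', mem_univ,
      if_true, sum_const, card_univ, Fintype.card_fin, nsmul_eq_mul] at h1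
    rw [h1]
    field_simp
  refine ⟨p, hp0, hpq, ?_, ?_⟩
  · have h1 := hpF fun x xh _ => δ x xh
    rw [sum_congr rfl fun x _ => sum_comm, h1, Fintype.sum_prod_type, mul_sum]
    refine sum_congr rfl fun x _ => ?_
    rw [mul_sum]
    refine sum_congr rfl fun y _ => ?_
    ring
  · let u : X → Xh → Y → ℝ := fun x xh y =>
      (p x xh y * (∑ x', ∑ xh', p x' xh' y)) / ((∑ xh', p x xh' y) * (∑ x', p x' xh y))
    have hu : ∑ s, Q s * ∑ i, Real.logb 2 (u (s.1 i) (h s i) (s.2 i)) =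
        n * condMutualInfo p := by
      have h1 := hpF fun x xh y => Real.logb 2 (u x xh y)
      have h2 : condMutualInfo p = ∑ x, ∑ xh, ∑ y, p x xh y * Real.logb 2 (u x xh y) := rfl
      rw [h2, h1]
      field_simp
    have hppos : ∀ s, 0 < Q s → ∀ i, 0 < p (s.1 i) (h s i) (s.2 i) := by
      intro s hs i
      refine mul_pos (by positivity) (sum_pos' (fun s _ => mul_nonneg (hQ0 s)
        (sum_nonneg fun i _ => by split_ifs <;> norm_num)) ⟨s, mem_univ _, mul_pos hs ?_⟩)
      exact sum_pos' (fun i _ => by split_ifs <;> norm_num) ⟨i, mem_univ _, by simp⟩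
    have hupos : ∀ s, 0 < Q s → ∀ i, 0 < u (s.1 i) (h s i) (s.2 i) := by
      intro s hs i
      have h0 := hppos s hs i
      have h1 := marginal_pos_right hp0 h0
      have h2 := marginal_pos_left hp0 h0
      have h3 := marginal_pos_both hp0 h0
      exact div_pos (mul_pos h0 h3) (mul_pos h1 h2)
    have hMpos : ∀ s : (Fin n → X) × (Fin n → Y), (0 : ℝ) < M := fun s => by
      exact_mod_cast (Nat.zero_le _).trans_lt (enc s.1 s.2).isLt
    -- The backward conditional law of `x` given `(xh, y)`, times the marginal of `y`. On the
    -- support it equals `q * u`.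
    let v : Xh → Y → X → ℝ := fun xh y x =>
      p x xh y / (∑ x', p x' xh y) * ∑ x', ∑ xh', p x' xh' y
    have hv0 : ∀ xh y x, 0 ≤ v xh y x := fun xh y x =>
      mul_nonneg (div_nonneg (hp0 _ _ _) (sum_nonneg fun _ _ => hp0 _ _ _))
        (sum_nonneg fun _ _ => sum_nonneg fun _ _ => hp0 _ _ _)
    have hv : ∀ xh y, ∑ x, v xh y x ≤ ∑ x', ∑ xh', p x' xh' y := by
      intro xh y
      simp only [v, ← sum_mul, ← sum_div]
      exact mul_le_of_le_one_left
        (sum_nonneg fun _ _ => sum_nonneg fun _ _ => hp0 _ _ _) (div_self_le_one _)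
    -- With this choice of `t` the Gibbs sum is `log M - n I(p)`, so its nonnegativity is the claim.
    have hgibbs := sum_mul_logb_nonneg Q
      (fun s => M / ∏ i, u (s.1 i) (h s i) (s.2 i)) hQ0
      (fun s hs => div_pos (hMpos s) (prod_pos fun i _ => hupos s hs i)) ?_
    · have e : ∀ s, Q s * Real.logb 2 (M / ∏ i, u (s.1 i) (h s i) (s.2 i)) =
          Q s * Real.logb 2 M - Q s * ∑ i, Real.logb 2 (u (s.1 i) (h s i) (s.2 i)) := by
        intro s
        rcases (hQ0 s).eq_or_lt with hs | hs
        · simp [← hs]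
        · rw [Real.logb_div (hMpos s).ne' (prod_pos fun i _ => hupos s hs i).ne',
            Real.logb_prod _ _ fun i _ => (hupos s hs i).ne']
          ring
      simp only [e, sum_sub_distrib, ← sum_mul, hQ1, hu] at hgibbs
      rw [le_div_iff₀ hn']
      linarith
    · have key : ∀ s, Q s / (M / ∏ i, u (s.1 i) (h s i) (s.2 i)) ≤
          ∑ m, (1 / M) * ∏ i, v (dec m s.2 i) (s.2 i) (s.1 i) := by
        intro s
        refine le_trans ?_ (single_le_sum (f := fun m => (1 / (M : ℝ)) *
          ∏ i, v (dec m s.2 i) (s.2 i) (s.1 i)) (fun m _ => mul_nonneg (by positivity)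
          (prod_nonneg fun _ _ => hv0 _ _ _)) (mem_univ (enc s.1 s.2)))
        rcases (hQ0 s).eq_or_lt with hs | hs
        · rw [← hs, zero_div]
          exact mul_nonneg (by positivity) (prod_nonneg fun _ _ => hv0 _ _ _)
        · apply le_of_eq
          rw [div_div_eq_mul_div, ← prod_mul_distrib, div_eq_inv_mul, one_div]
          congr 1
          refine prod_congr rfl fun i _ => ?_
          have h0 := hppos s hs i
          have h1 := marginal_pos_right hp0 h0
          have h2 := marginal_pos_left hp0 h0
          have h3 : 0 < q (s.1 i, s.2 i) := hpq (s.1 i) (s.2 i) ▸ h1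
          simp only [u, v, hpq]
          change _ = p (s.1 i) (h s i) (s.2 i) / (∑ x', p x' (h s i) (s.2 i)) * _
          field_simp
      have hqY : ∑ y, ∑ x', ∑ xh', p x' xh' y = 1 := by
        simp only [hpq]
        rw [sum_comm, ← Fintype.sum_prod_type' fun x y => q (x, y)]
        exact hq.2
      rw [hQ1]
      calc _ ≤ ∑ s : (Fin n → X) × (Fin n → Y),
              ∑ m, (1 / (M : ℝ)) * ∏ i, v (dec m s.2 i) (s.2 i) (s.1 i) :=
            sum_le_sum fun s _ => key s
        _ = ∑ y : Fin n → Y, ∑ m, (1 / (M : ℝ)) * ∏ i, ∑ x, v (dec m y i) (y i) x := by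
            rw [Fintype.sum_prod_type_right]
            refine sum_congr rfl fun y _ => ?_
            rw [sum_comm]
            refine sum_congr rfl fun m _ => ?_
            rw [← mul_sum, sum_prod_apply fun i => v (dec m y i) (y i)]
        _ ≤ ∑ y : Fin n → Y, ∑ m : Fin M, (1 / (M : ℝ)) * ∏ i, ∑ x', ∑ xh', p x' xh' (y i) := by
            refine sum_le_sum fun y _ => sum_le_sum fun m _ =>
              mul_le_mul_of_nonneg_left ?_ (by positivity)
            exact prod_le_prod (fun i _ => sum_nonneg fun _ _ => hv0 _ _ _) fun i _ => hv _ _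
        _ = ∑ m : Fin M, 1 / (M : ℝ) := by
            rw [sum_comm]
            refine sum_congr rfl fun m _ => ?_
            rw [← mul_sum, sum_prod_apply fun _ y => ∑ x', ∑ xh', p x' xh' y]
            simp [hqY]
        _ ≤ 1 := by
            rw [sum_const, card_univ, Fintype.card_fin, nsmul_eq_mul, mul_one_div]
            exact div_self_le_one _

theorem condRD_le_of_codes {X Y Xh : Type*} [Fintype X] [Fintype Y] [Fintype Xh] [Nonempty Xh]
    {q : X × Y → ℝ} (hq : q ∈ stdSimplex ℝ (X × Y)) {δ : X → Xh → ℝ} {d r : ℝ}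
    (h : ∀ ε : ℝ, 0 < ε → ∃ n : ℕ, 0 < n ∧ ∃ (M : ℕ) (enc : (Fin n → X) → (Fin n → Y) → Fin M)
      (dec : Fin M → (Fin n → Y) → Fin n → Xh), Real.logb 2 M / n ≤ r + ε ∧
      ∑ x : Fin n → X, ∑ y : Fin n → Y, (∏ i, q (x i, y i)) *
          ((1 / (n : ℝ)) * ∑ i, δ (x i) (dec (enc x y) y i)) ≤ d + ε) :
    condRD q δ d ≤ r := by
  refine condRD_le_of_forall_pos hq.1 fun ε hε => ?_
  obtain ⟨n, hn, M, enc, dec, hr, hd⟩ := h ε hε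
  obtain ⟨p, hp0, hpq, hpd, hpI⟩ := exists_pmf_of_code hq δ hn enc dec
  obtain ⟨W, hW, hWp⟩ := exists_channel hp0 hpq
  refine ⟨W, hW, ?_, ?_⟩
  · simp only [hWp]
    exact hpd.trans_le hd
  · simp only [hWp]
    exact hpI.trans hr

/-! ### Rate loss of the Wyner-Ziv test channel `A = X + N` -/

theorem sum_sub_right {l : ℕ} [NeZero l] (f : ZMod l → ℝ) (w : ZMod l) :
    ∑ z, f (z - w) = ∑ z, f z :=
  (Equiv.subRight w).sum_comp f

/-- Makes the supremum in `addCapacity` genuine, as `sSup` of an unbounded set of reals is 0. Each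
summand is at most `1 / log 2`, because `log x ≤ x` and a joint probability is at most its marginal.
-/
theorem bddAbove_mutualInfo_add {l : ℕ} [NeZero l] (ρ : ZMod l → ℝ) (d : ℝ)
    {pN : ZMod l → ℝ} (hN : pN ∈ stdSimplex ℝ (ZMod l)) :
    BddAbove {r : ℝ | ∃ pW ∈ stdSimplex ℝ (ZMod l), ∑ w, pW w * ρ w ≤ d ∧
      r = mutualInfo (fun w z => pW w * pN (z - w))} := by
  have hlog : 0 < Real.log 2 := Real.log_pos one_lt_two
  refine ⟨∑ _w : ZMod l, ∑ _z : ZMod l, 1 / Real.log 2, ?_⟩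
  rintro _ ⟨pW, hW, -, rfl⟩
  refine sum_le_sum fun w _ => sum_le_sum fun z _ => ?_
  have hp : ∀ w z, 0 ≤ pW w * pN (z - w) := fun w z => mul_nonneg (hW.1 _) (hN.1 _)
  have h1 : ∑ z', pW w * pN (z' - w) = pW w := by
    rw [← mul_sum, sum_sub_right, hN.2, mul_one]
  beta_reduce
  rw [h1]
  rcases (hp w z).eq_or_lt with h | h
  · rw [← h, zero_mul]; positivity
  · have hw : 0 < pW w := (hW.1 w).lt_of_ne fun h' => by rw [← h', zero_mul] at h; exact h.false
    have hle : pW w * pN (z - w) ≤ ∑ w', pW w' * pN (z - w') :=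
      single_le_sum (f := fun w' => pW w' * pN (z - w')) (fun w' _ => hp w' z) (mem_univ w)
    have hz := h.trans_le hle
    set D := ∑ w', pW w' * pN (z - w')
    rw [Real.logb, ← mul_div_assoc]
    gcongr
    have hn : 0 < pN (z - w) := (pos_iff_pos_of_mul_pos h).1 hw
    have hn1 : pN (z - w) ≤ 1 := hN.2 ▸ single_le_sum (fun i _ => hN.1 i) (mem_univ (z - w))
    have e : pW w * pN (z - w) / (pW w * D) = pN (z - w) / D := by field_simp
    rw [e]
    calc pW w * pN (z - w) * Real.log (pN (z - w) / D)
        ≤ pW w * pN (z - w) * (pN (z - w) / D) := by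
          gcongr
          exact (Real.log_le_sub_one_of_pos (by positivity)).trans (by linarith)
      _ = pN (z - w) * (pW w * pN (z - w) / D) := by ring
      _ ≤ 1 * 1 := by
          gcongr
          exact (div_le_one hz).2 hle
      _ = 1 := one_mul 1

/-- `I(X; X + N | Y) ≤ I(X; X̂ | Y) + I(W; W + N)` with `W = X - X̂`, for noise `N` independent
of everything else. -/
theorem condMutualInfo_add_noise_le {Y : Type*} [Fintype Y] {l : ℕ} [NeZero l]
    {pN : ZMod l → ℝ} (hN : pN ∈ stdSimplex ℝ (ZMod l)) {p : ZMod l → ZMod l → Y → ℝ}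
    (hp0 : ∀ x xh y, 0 ≤ p x xh y) (hp1 : ∑ x, ∑ xh, ∑ y, p x xh y = 1) :
    condMutualInfo (fun x a y => (∑ xh, p x xh y) * pN (a - x)) ≤ condMutualInfo p +
      mutualInfo (fun w z => (∑ xh, ∑ y, p (w + xh) xh y) * pN (z - w)) := by
  let pXY : ZMod l → Y → ℝ := fun x y => ∑ xh, p x xh y
  let pHY : ZMod l → Y → ℝ := fun xh y => ∑ x, p x xh y
  let r : Y → ℝ := fun y => ∑ x, ∑ xh, p x xh y
  let pA : ZMod l → Y → ℝ := fun a y => ∑ x, pXY x y * pN (a - x)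
  let pW : ZMod l → ℝ := fun w => ∑ xh, ∑ y, p (w + xh) xh y
  let pV : ZMod l → ℝ := fun v => ∑ w, pW w * pN (v - w)
  have hXY0 : ∀ x y, 0 ≤ pXY x y := fun _ _ => sum_nonneg fun _ _ => hp0 _ _ _
  have hHY0 : ∀ x y, 0 ≤ pHY x y := fun _ _ => sum_nonneg fun _ _ => hp0 _ _ _
  have hW0 : ∀ w, 0 ≤ pW w := fun _ => sum_nonneg fun _ _ => sum_nonneg fun _ _ => hp0 _ _ _
  have hA0 : ∀ a y, 0 ≤ pA a y := fun _ _ => sum_nonneg fun _ _ => mul_nonneg (hXY0 _ _) (hN.1 _)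
  have hV0 : ∀ v, 0 ≤ pV v := fun _ => sum_nonneg fun _ _ => mul_nonneg (hW0 _) (hN.1 _)
  have hN1 : ∀ x, ∑ a, pN (a - x) = 1 := fun x => by rw [sum_sub_right, hN.2]
  -- The joint law of `(X, X̂, Y, A)` with `A = X + N`. All three informations are expectations of
  -- log ratios under it.
  let P : ZMod l × ZMod l × Y × ZMod l → ℝ := fun s => p s.1 s.2.1 s.2.2.1 * pN (s.2.2.2 - s.1)
  have hP0 : ∀ s, 0 ≤ P s := fun s => mul_nonneg (hp0 _ _ _) (hN.1 _)
  have hsupp : ∀ x xh y a, 0 < p x xh y * pN (a - x) → 0 < p x xh y ∧ 0 < pN (a - x) := by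
    intro x xh y a h
    exact ⟨(hp0 _ _ _).lt_of_ne fun h' => by rw [← h', zero_mul] at h; exact h.false,
      (hN.1 _).lt_of_ne fun h' => by rw [← h', mul_zero] at h; exact h.false⟩
  have hpos : ∀ x xh y a, 0 < p x xh y → 0 < pN (a - x) →
      0 < pXY x y ∧ 0 < pHY xh y ∧ 0 < r y ∧ 0 < pA a y ∧ 0 < pV (a - xh) := by
    intro x xh y a h hn
    have h1 : 0 < pXY x y := marginal_pos_right hp0 h
    refine ⟨h1, marginal_pos_left hp0 h, marginal_pos_both hp0 h, ?_, ?_⟩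
    · exact sum_pos' (fun _ _ => mul_nonneg (hXY0 _ _) (hN.1 _)) ⟨x, mem_univ _, mul_pos h1 hn⟩
    · refine sum_pos' (fun _ _ => mul_nonneg (hW0 _) (hN.1 _)) ⟨x - xh, mem_univ _, ?_⟩
      refine mul_pos (sum_pos' (fun _ _ => sum_nonneg fun _ _ => hp0 _ _ _)
        ⟨xh, mem_univ _, sum_pos' (fun _ _ => hp0 _ _ _) ⟨y, mem_univ _, ?_⟩⟩) ?_
      · rwa [sub_add_cancel]
      · rwa [sub_sub_sub_cancel_right]
  have e1 : condMutualInfo (fun x a y => (∑ xh, p x xh y) * pN (a - x)) =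
      ∑ s, P s * Real.logb 2 (pN (s.2.2.2 - s.1) * r s.2.2.1 / pA s.2.2.2 s.2.2.1) := by
    have h1 : ∀ x y, ∑ a, (∑ xh, p x xh y) * pN (a - x) = pXY x y := fun x y => by
      rw [← mul_sum, hN1, mul_one]
    simp only [condMutualInfo, h1, Fintype.sum_prod_type]
    refine sum_congr rfl fun x _ => ?_
    rw [sum_comm, sum_comm (f := fun xh y => ∑ a, P (x, xh, y, a) * _)]
    refine sum_congr rfl fun y _ => ?_
    rw [sum_comm (f := fun xh a => P (x, xh, y, a) * _)]
    refine sum_congr rfl fun a _ => ?_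
    have h2 : pXY x y * pN (a - x) *
        Real.logb 2 (pXY x y * pN (a - x) * r y / (pXY x y * pA a y)) =
        (∑ xh, p x xh y) * pN (a - x) * Real.logb 2 (pN (a - x) * r y / pA a y) := by
      rcases (hXY0 x y).eq_or_lt with h | h
      · change _ = pXY x y * _ * _
        rw [← h, zero_mul, zero_mul, zero_mul]
      · congr 2
        rw [mul_assoc (pXY x y) (pN (a - x)), mul_div_mul_left _ _ h.ne']
    refine h2.trans ?_
    rw [sum_mul, sum_mul]
  have e2 : condMutualInfo p = ∑ s, P s * Real.logb 2
      (p s.1 s.2.1 s.2.2.1 * r s.2.2.1 / (pXY s.1 s.2.2.1 * pHY s.2.1 s.2.2.1)) := by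
    simp only [condMutualInfo, Fintype.sum_prod_type]
    refine sum_congr rfl fun x _ => sum_congr rfl fun xh _ => sum_congr rfl fun y _ => ?_
    simp only [P]
    rw [← sum_mul, ← mul_sum, hN1, mul_one]
  have e3 : mutualInfo (fun w z => (∑ xh, ∑ y, p (w + xh) xh y) * pN (z - w)) =
      ∑ s, P s * Real.logb 2 (pN (s.2.2.2 - s.1) / pV (s.2.2.2 - s.2.1)) := by
    have h1 : ∀ w, ∑ z, (∑ xh, ∑ y, p (w + xh) xh y) * pN (z - w) = pW w := fun w => by
      rw [← mul_sum, hN1, mul_one]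
    have h2 : ∀ xh, ∑ x, ∑ y, ∑ a, P (x, xh, y, a) * Real.logb 2 (pN (a - x) / pV (a - xh)) =
        ∑ w, ∑ y, ∑ z, p (w + xh) xh y * pN (z - w) * Real.logb 2 (pN (z - w) / pV z) := by
      intro xh
      rw [← Equiv.sum_comp (Equiv.addRight xh)]
      refine sum_congr rfl fun w _ => sum_congr rfl fun y _ => ?_
      rw [← Equiv.sum_comp (Equiv.addRight xh)]
      refine sum_congr rfl fun z _ => ?_
      simp only [P, Equiv.coe_addRight, add_sub_add_right_eq_sub, add_sub_cancel_right]
    simp only [mutualInfo, h1, Fintype.sum_prod_type]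
    rw [sum_comm (f := fun x xh => ∑ y, ∑ a, P (x, xh, y, a) * _), sum_congr rfl fun xh _ => h2 xh,
      sum_comm (f := fun xh w => ∑ y, ∑ z,
        p (w + xh) xh y * pN (z - w) * Real.logb 2 (pN (z - w) / pV z))]
    refine sum_congr rfl fun w _ => ?_
    rw [sum_congr rfl fun xh _ => sum_comm (f := fun y z =>
      p (w + xh) xh y * pN (z - w) * Real.logb 2 (pN (z - w) / pV z)),
      sum_comm (f := fun xh z => ∑ y,
        p (w + xh) xh y * pN (z - w) * Real.logb 2 (pN (z - w) / pV z))]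
    refine sum_congr rfl fun z _ => ?_
    simp only [← sum_mul]
    change pW w * pN (z - w) * Real.logb 2 (pW w * pN (z - w) / (pW w * pV z)) =
      pW w * pN (z - w) * _
    rcases (hW0 w).eq_or_lt with h | h
    · rw [← h, zero_mul, zero_mul, zero_mul]
    · rw [mul_div_mul_left _ _ h.ne']
  -- The ratio is the product of the densities of `I(X;X̂|Y)` and `I(W;W+N)` divided by that of
  -- `I(X;A|Y)`. In `P / t` the sum over `x` rebuilds `pA` and cancels the denominator, leaving at
  -- most a total mass of 1.
  have hgibbs := sum_mul_logb_nonneg P (fun s => p s.1 s.2.1 s.2.2.1 * pA s.2.2.2 s.2.2.1 /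
    (pXY s.1 s.2.2.1 * pHY s.2.1 s.2.2.1 * pV (s.2.2.2 - s.2.1))) hP0 ?_ ?_
  · rw [e1, e2, e3, ← sum_add_distrib]
    have e : ∀ s, P s * Real.logb 2 (p s.1 s.2.1 s.2.2.1 * pA s.2.2.2 s.2.2.1 /
        (pXY s.1 s.2.2.1 * pHY s.2.1 s.2.2.1 * pV (s.2.2.2 - s.2.1))) =
        (P s * Real.logb 2
          (p s.1 s.2.1 s.2.2.1 * r s.2.2.1 / (pXY s.1 s.2.2.1 * pHY s.2.1 s.2.2.1)) +
        P s * Real.logb 2 (pN (s.2.2.2 - s.1) / pV (s.2.2.2 - s.2.1))) -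
        P s * Real.logb 2 (pN (s.2.2.2 - s.1) * r s.2.2.1 / pA s.2.2.2 s.2.2.1) := by
      intro s
      rcases (hP0 s).eq_or_lt with h | h
      · simp [← h]
      · obtain ⟨h2, h3⟩ := hsupp _ _ _ _ h
        obtain ⟨h4, h5, h6, h7, h8⟩ := hpos _ _ _ _ h2 h3
        rw [← mul_add, ← mul_sub, ← Real.logb_mul (by positivity) (by positivity),
          ← Real.logb_div (by positivity) (by positivity)]
        congr 2
        field_simp
    simp only [e, sum_sub_distrib] at hgibbs
    linarith
  · intro s h
    obtain ⟨h2, h3⟩ := hsupp _ _ _ _ h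
    obtain ⟨h4, h5, h6, h7, h8⟩ := hpos _ _ _ _ h2 h3
    positivity
  · have hV1 : ∑ v, pV v = 1 := by
      simp only [pV]
      rw [sum_comm]
      simp only [← mul_sum, hN1, mul_one, pW]
      rw [sum_comm, ← hp1, sum_comm (f := fun x xh => ∑ y, p x xh y)]
      exact sum_congr rfl fun xh _ => Equiv.sum_comp (Equiv.addRight xh) fun x => ∑ y, p x xh y
    have hP1 : ∑ s, P s = 1 := by
      simp only [Fintype.sum_prod_type, P, ← mul_sum, hN1, mul_one, hp1]
    rw [hP1]
    calc _ ≤ ∑ s : ZMod l × ZMod l × Y × ZMod l, pXY s.1 s.2.2.1 * pN (s.2.2.2 - s.1) *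
            (pHY s.2.1 s.2.2.1 * pV (s.2.2.2 - s.2.1)) / pA s.2.2.2 s.2.2.1 := by
          refine sum_le_sum fun s _ => ?_
          rcases (hP0 s).eq_or_lt with h | h
          · rw [← h, zero_div]
            exact div_nonneg (mul_nonneg (mul_nonneg (hXY0 _ _) (hN.1 _))
              (mul_nonneg (hHY0 _ _) (hV0 _))) (hA0 _ _)
          · obtain ⟨h2, h3⟩ := hsupp _ _ _ _ h
            obtain ⟨h4, h5, h6, h7, h8⟩ := hpos _ _ _ _ h2 h3
            apply le_of_eq
            simp only [P]
            field_simp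
      _ = ∑ xh, ∑ y, ∑ a, pA a y * (pHY xh y * pV (a - xh)) / pA a y := by
          simp only [Fintype.sum_prod_type]
          rw [sum_comm]
          refine sum_congr rfl fun xh _ => ?_
          rw [sum_comm]
          refine sum_congr rfl fun y _ => ?_
          rw [sum_comm]
          refine sum_congr rfl fun a _ => ?_
          rw [← sum_div, ← sum_mul]
      _ ≤ ∑ xh, ∑ y, ∑ a, pHY xh y * pV (a - xh) := by
          refine sum_le_sum fun xh _ => sum_le_sum fun y _ => sum_le_sum fun a _ => ?_
          rw [mul_div_right_comm]
          exact mul_le_of_le_one_left (mul_nonneg (hHY0 _ _) (hV0 _)) (div_self_le_one _)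
      _ = 1 := by
          simp only [← mul_sum, sum_sub_right, hV1, mul_one, pHY]
          rw [← hp1, sum_comm (f := fun x xh => ∑ y, p x xh y)]
          exact sum_congr rfl fun xh _ => sum_comm

theorem condMutualInfo_equiv {U V T U' V' : Type*} [Fintype U] [Fintype V] [Fintype T]
    [Fintype U'] [Fintype V'] (e : U ≃ U') (f : V ≃ V') (p : U' → V' → T → ℝ) :
    condMutualInfo (fun u v t => p (e u) (f v) t) = condMutualInfo p := by
  have h1 : ∀ u t, ∑ v, p u (f v) t = ∑ v, p u v t := fun u t => f.sum_comp fun v => p u v t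
  have h2 : ∀ v t, ∑ u, p (e u) v t = ∑ u, p u v t := fun v t => e.sum_comp fun u => p u v t
  have h3 : ∀ t, ∑ u, ∑ v, p (e u) v t = ∑ u, ∑ v, p u v t := fun t =>
    e.sum_comp fun u => ∑ v, p u v t
  simp only [condMutualInfo, h1, h2, h3]
  rw [← e.sum_comp]
  refine sum_congr rfl fun u _ => ?_
  rw [← f.sum_comp]

/-- Normality gives a deterministic channel, so the infimum defining `condRD` is over a nonempty set
for every `d ≥ 0`. -/
theorem exists_channel_dist_eq_zero {X Y Xh : Type*} [Fintype X] [Fintype Y] [Fintype Xh]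
    (q : X × Y → ℝ) {δ : X → Xh → ℝ} (hδ : IsNormalDistortion δ) :
    ∃ W : X × Y → Xh → ℝ, (∀ s, W s ∈ stdSimplex ℝ Xh) ∧
      ∑ x, ∑ y, ∑ xh, W (x, y) xh * q (x, y) * δ x xh = 0 := by
  classical
  choose g hg using hδ.normal
  refine ⟨fun s => Pi.single (g s.1) 1, fun s => single_mem_stdSimplex ℝ _, ?_⟩
  refine sum_eq_zero fun x _ => sum_eq_zero fun y _ => sum_eq_zero fun xh _ => ?_
  rcases eq_or_ne xh (g x) with rfl | h
  · rw [hg, mul_zero]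
  · simp [h]

theorem wzRD_le {X Y Xh : Type*} [Fintype X] [Fintype Y] {q : X × Y → ℝ} {δ : X → Xh → ℝ}
    {d : ℝ} {k : ℕ} (hk : k ≤ Fintype.card X + 1) (p : Fin k → X → Y → ℝ)
    (hp : ∀ a x y, 0 ≤ p a x y) (hpq : ∀ x y, ∑ a, p a x y = q (x, y))
    (hM : ∀ a x y, p a x y * (∑ a', ∑ y', p a' x y') = (∑ y', p a x y') * (∑ a', p a' x y))
    (π : Fin k → Y → Xh) (hd : ∑ a, ∑ x, ∑ y, p a x y * δ x (π a y) ≤ d) :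
    wzRD q δ d ≤ condMutualInfo (fun x a y => p a x y) := by
  refine csInf_le ⟨0, ?_⟩ ⟨k, hk, p, hp, hpq, hM, ⟨π, hd⟩, rfl⟩
  rintro _ ⟨k', -, p', hp', -, -, -, rfl⟩
  exact condMutualInfo_nonneg fun _ _ _ => hp' _ _ _

/-- The Wyner-Ziv rate loss is at most the minimax capacity. -/
theorem wzRD_sub_condRD_le_minimaxCapacity {X Y Xh : Type*} [Fintype X] [Fintype Y] [Fintype Xh]
    {q : X × Y → ℝ} (hq : q ∈ stdSimplex ℝ (X × Y)) {δ : X → Xh → ℝ}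
    (hδ : IsNormalDistortion δ) {d : ℝ} (hd : 0 ≤ d) {l : ℕ} [NeZero l] {ρ : ZMod l → ℝ}
    (hρ : IsDifferenceDistortion δ l ρ) :
    wzRD q δ d - condRD q δ d ≤ minimaxCapacity ρ (fun z => ρ (-z)) d := by
  classical
  obtain ⟨e, eh, hδρ⟩ := hρ
  refine le_csInf ?_ ?_
  -- An admissible noise exists: if `xh` reproduces the letter 0 without distortion, the constant
  -- noise `eh xh` has `ρ (-N) = 0`.
  · obtain ⟨xh, hxh⟩ := hδ.normal (e.symm 0)
    refine ⟨_, Pi.single (eh xh) 1, single_mem_stdSimplex ℝ _, ?_, rfl⟩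
    rw [hδρ, Equiv.apply_symm_apply, zero_sub] at hxh
    refine (sum_eq_zero fun z _ => ?_).trans_le hd
    rcases eq_or_ne z (eh xh) with rfl | h
    · beta_reduce
      rw [hxh, mul_zero]
    · simp [h]
  rintro _ ⟨pN, hN, hNd, rfl⟩
  rw [sub_le_comm]
  refine le_csInf ?_ ?_
  · obtain ⟨W, hW, hWd⟩ := exists_channel_dist_eq_zero q hδ
    exact ⟨_, W, hW, hWd.trans_le hd, rfl⟩
  rintro _ ⟨W, hW, hWd, rfl⟩
  rw [sub_le_iff_le_add]
  let f : Fin l ≃ ZMod l := (Fintype.equivFinOfCardEq (ZMod.card l)).symm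
  have hN1 : ∀ x, ∑ a, pN (f a - x) = 1 := fun x => by
    rw [f.sum_comp fun a => pN (a - x), sum_sub_right, hN.2]
  -- Test channel `A = X + N`, with a decoder that outputs `A` and ignores `y`. The error is `X - A
  -- = -N`, whence the reflected constraint on the noise.
  have hwz := wzRD_le (q := q) (δ := δ) (d := d) (k := l)
    (((ZMod.card l).symm.trans (Fintype.card_congr e).symm).le.trans (Nat.le_succ _))
    (fun a x y => q (x, y) * pN (f a - e x)) (fun a x y => mul_nonneg (hq.1 _) (hN.1 _))
    (fun x y => by rw [← mul_sum, hN1, mul_one])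
    (fun a x y => by
      rw [sum_comm]
      simp only [← mul_sum, hN1, mul_one, ← sum_mul]
      ring)
    (fun a _ => eh.symm (f a)) (by
      rw [sum_comm]
      have h1 : ∀ x, ∑ a, ∑ y, q (x, y) * pN (f a - e x) * δ x (eh.symm (f a)) =
          ∑ y, q (x, y) * ∑ z, pN z * ρ (-z) := by
        intro x
        rw [sum_comm]
        refine sum_congr rfl fun y _ => ?_
        rw [← sum_sub_right _ (e x), ← f.sum_comp, mul_sum]
        refine sum_congr rfl fun a _ => ?_
        rw [hδρ, Equiv.apply_symm_apply, neg_sub, mul_assoc]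
      simp only [h1]
      simp only [← sum_mul]
      rw [← Fintype.sum_prod_type' fun x y => q (x, y), hq.2, one_mul]
      exact hNd)
  let p : ZMod l → ZMod l → Y → ℝ := fun x xh y =>
    W (e.symm x, y) (eh.symm xh) * q (e.symm x, y)
  have hp0 : ∀ x xh y, 0 ≤ p x xh y := fun x xh y => mul_nonneg ((hW _).1 _) (hq.1 _)
  have hpq : ∀ x y, ∑ xh, p x xh y = q (e.symm x, y) := by
    intro x y
    simp only [p, ← sum_mul]
    rw [eh.symm.sum_comp fun xh => W (e.symm x, y) xh, (hW _).2, one_mul]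
  have hp1 : ∑ x, ∑ xh, ∑ y, p x xh y = 1 := by
    rw [sum_congr rfl fun x _ => sum_comm]
    simp only [hpq]
    rw [e.symm.sum_comp fun x => ∑ y, q (x, y), ← Fintype.sum_prod_type' fun x y => q (x, y), hq.2]
  have hpF : ∀ F : ZMod l → ℝ, ∑ w, (∑ xh, ∑ y, p (w + xh) xh y) * F w =
      ∑ x, ∑ xh, ∑ y, p x xh y * F (x - xh) := by
    intro F
    simp only [sum_mul]
    rw [sum_comm, sum_comm (f := fun x xh => ∑ y, p x xh y * F (x - xh))]
    refine sum_congr rfl fun xh _ => ?_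
    rw [← Equiv.sum_comp (Equiv.addRight xh) fun x => ∑ y, p x xh y * F (x - xh)]
    simp
  have hmain := condMutualInfo_add_noise_le hN hp0 hp1
  have h1 : condMutualInfo (fun x a y => q (x, y) * pN (f a - e x)) =
      condMutualInfo (fun x a y => (∑ xh, p x xh y) * pN (a - x)) := by
    rw [← condMutualInfo_equiv e f]
    simp only [hpq, Equiv.symm_apply_apply]
  have h2 : condMutualInfo (fun x xh y => W (x, y) xh * q (x, y)) = condMutualInfo p := by
    rw [← condMutualInfo_equiv e eh]
    simp only [p, Equiv.symm_apply_apply]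
  rw [← h1, ← h2] at hmain
  refine hwz.trans (hmain.trans ?_)
  refine add_le_add_right ?_ _
  refine le_csSup (bddAbove_mutualInfo_add ρ d hN)
    ⟨fun w => ∑ xh, ∑ y, p (w + xh) xh y, ⟨fun w => sum_nonneg fun _ _ => sum_nonneg fun _ _ =>
      hp0 _ _ _, ?_⟩, ?_, rfl⟩
  · simpa [hp1] using hpF fun _ => 1
  · rw [hpF]
    refine le_trans (le_of_eq ?_) hWd
    rw [← e.symm.sum_comp]
    refine sum_congr rfl fun x _ => ?_
    rw [sum_comm]
    refine sum_congr rfl fun y _ => ?_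
    rw [← eh.symm.sum_comp]
    refine sum_congr rfl fun xh _ => ?_
    rw [hδρ, Equiv.apply_symm_apply, Equiv.apply_symm_apply]

/-! ### One-shot Wyner-Ziv coding -/

theorem sum_mul_abs_le_sqrt {S : Type*} [Fintype S] {w : S → ℝ} (hw0 : ∀ s, 0 ≤ w s)
    (hw : ∑ s, w s = 1) (h : S → ℝ) : ∑ s, w s * |h s| ≤ √(∑ s, w s * h s ^ 2) := by
  apply Real.le_sqrt_of_sq_le
  have := sum_sq_le_sum_mul_sum_of_sq_le_mul univ (r := fun s => w s * |h s|) (f := w)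
    (g := fun s => w s * h s ^ 2) (fun s _ => hw0 s)
    (fun s _ => mul_nonneg (hw0 s) (sq_nonneg _)) (fun s _ => by rw [mul_pow, sq_abs]; exact le_of_eq (by ring))
  rwa [hw, one_mul] at this

/-- Soft covering: the output distribution of a random codebook is close to `PX` on average. -/
theorem soft_covering {ι A X : Type*} [Fintype ι] [Nonempty ι] [DecidableEq ι] [Fintype A]
    [Fintype X] {PA : A → ℝ} (hA0 : ∀ a, 0 ≤ PA a) (hA : ∑ a, PA a = 1) {V : A → X → ℝ}
    (hV0 : ∀ a x, 0 ≤ V a x) {PX : X → ℝ} (hPX : ∀ x, ∑ a, PA a * V a x = PX x)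
    (hX : ∑ x, PX x = 1) {γ : ℝ} (hγ : 0 ≤ γ) :
    ∑ c : ι → A, (∏ i, PA (c i)) * ∑ x, |PX x - 1 / Fintype.card ι * ∑ i, V (c i) x| ≤
      √(γ / Fintype.card ι) +
        2 * ∑ a, ∑ x, PA a * V a x * (if γ * PX x < V a x then 1 else 0) := by
  have hL : (0 : ℝ) < Fintype.card ι := by exact_mod_cast Fintype.card_pos
  set L := (Fintype.card ι : ℝ)
  have hw0 : ∀ c : ι → A, 0 ≤ ∏ i, PA (c i) := fun c => prod_nonneg fun _ _ => hA0 _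
  have hw1 : ∑ c : ι → A, ∏ i, PA (c i) = 1 := sum_iid hA
  have hPX0 : ∀ x, 0 ≤ PX x := fun x => hPX x ▸
    sum_nonneg fun _ _ => mul_nonneg (hA0 _) (hV0 _ _)
  have key : ∀ x, ∑ c : ι → A, (∏ i, PA (c i)) * |PX x - 1 / L * ∑ i, V (c i) x| ≤
      PX x * √(γ / L) + 2 * ∑ a, PA a * V a x * (if γ * PX x < V a x then 1 else 0) := by
    intro x
    -- Truncation at likelihood ratio `γ`. The bounded part `V1` has variance at most `γ * PX x ^
    -- 2`; the tail `V2` enters once through the codebook average and once through its mean, giving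
    -- the factor 2.
    let V1 : A → ℝ := fun a => if γ * PX x < V a x then 0 else V a x
    let V2 : A → ℝ := fun a => V a x * (if γ * PX x < V a x then 1 else 0)
    have hV12 : ∀ a, V a x = V1 a + V2 a := fun a => by
      simp only [V1, V2]; split_ifs <;> ring
    have hV10 : ∀ a, 0 ≤ V1 a := fun a => by
      simp only [V1]; split_ifs <;> [exact le_rfl; exact hV0 _ _]
    have hV20 : ∀ a, 0 ≤ V2 a := fun a => mul_nonneg (hV0 _ _) (by split_ifs <;> norm_num)
    have hV1le : ∀ a, V1 a ≤ γ * PX x := fun a => by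
      simp only [V1]
      split_ifs with h
      · exact mul_nonneg hγ (hPX0 x)
      · exact not_lt.1 h
    set m1 := ∑ a, PA a * V1 a
    set m2 := ∑ a, PA a * V2 a with hm2
    have hm : PX x = m1 + m2 := by
      rw [← hPX x, ← sum_add_distrib]
      exact sum_congr rfl fun a _ => by rw [hV12, mul_add]
    have hm20 : 0 ≤ m2 := sum_nonneg fun _ _ => mul_nonneg (hA0 _) (hV20 _)
    have hg0 : ∑ a, PA a * (V1 a - m1) = 0 := by
      simp only [mul_sub, sum_sub_distrib, ← sum_mul, hA]
      simp [m1]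
    have hg2 : ∑ a, PA a * (V1 a - m1) ^ 2 ≤ γ * PX x ^ 2 := by
      calc ∑ a, PA a * (V1 a - m1) ^ 2 = ∑ a, PA a * V1 a ^ 2 - m1 ^ 2 := by
            have e : ∀ a, PA a * (V1 a - m1) ^ 2 =
                PA a * V1 a ^ 2 - 2 * m1 * (PA a * V1 a) + m1 ^ 2 * PA a := fun a => by ring
            simp only [e, sum_add_distrib, sum_sub_distrib, ← mul_sum, hA]
            change _ - 2 * m1 * m1 + _ = _
            ring
        _ ≤ ∑ a, PA a * V1 a ^ 2 := by linarith [sq_nonneg m1]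
        _ ≤ ∑ a, (γ * PX x) * (PA a * V1 a) := by
            refine sum_le_sum fun a _ => ?_
            rw [sq, ← mul_assoc, mul_comm (γ * PX x)]
            exact mul_le_mul_of_nonneg_left (hV1le a) (mul_nonneg (hA0 a) (hV10 a))
        _ = γ * PX x * m1 := by rw [← mul_sum]
        _ ≤ γ * PX x * PX x := by
            refine mul_le_mul_of_nonneg_left ?_ (mul_nonneg hγ (hPX0 x))
            linarith
        _ = _ := by ring
    have hpt : ∀ c : ι → A, |PX x - 1 / L * ∑ i, V (c i) x| ≤
        1 / L * |∑ i, (V1 (c i) - m1)| + 1 / L * ∑ i, V2 (c i) + m2 := by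
      intro c
      have e : PX x - 1 / L * ∑ i, V (c i) x =
          -(1 / L * ∑ i, (V1 (c i) - m1)) - 1 / L * ∑ i, V2 (c i) + m2 := by
        simp only [hV12, sum_add_distrib, sum_sub_distrib, sum_const, card_univ, nsmul_eq_mul, hm]
        change _ = -(1 / L * (_ - L * m1)) - _ + _
        field_simp
        ring
      have h2 : 0 ≤ 1 / L * ∑ i, V2 (c i) :=
        mul_nonneg (by positivity) (sum_nonneg fun _ _ => hV20 _)
      rw [e]
      refine (abs_add_le _ _).trans (add_le_add ((abs_sub _ _).trans ?_) (abs_of_nonneg hm20).le)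
      rw [abs_neg, abs_mul, abs_of_nonneg h2, abs_of_nonneg (by positivity : 0 ≤ 1 / L)]
    calc _ ≤ ∑ c : ι → A, (∏ i, PA (c i)) *
            (1 / L * |∑ i, (V1 (c i) - m1)| + 1 / L * ∑ i, V2 (c i) + m2) :=
          sum_le_sum fun c _ => mul_le_mul_of_nonneg_left (hpt c) (hw0 c)
      _ = 1 / L * ∑ c : ι → A, (∏ i, PA (c i)) * |∑ i, (V1 (c i) - m1)| +
            1 / L * ∑ i, ∑ c : ι → A, (∏ i, PA (c i)) * V2 (c i) + m2 := by
          have e : ∀ c : ι → A, (∏ i, PA (c i)) *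
              (1 / L * |∑ i, (V1 (c i) - m1)| + 1 / L * ∑ i, V2 (c i) + m2) =
              1 / L * ((∏ i, PA (c i)) * |∑ i, (V1 (c i) - m1)|) +
              1 / L * ∑ i, (∏ i, PA (c i)) * V2 (c i) + (∏ i, PA (c i)) * m2 := fun c => by
            rw [← mul_sum]; ring
          simp only [e, sum_add_distrib, ← mul_sum, ← sum_mul, hw1, one_mul]
          rw [mul_sum, sum_comm]
          simp only [mul_sum]
      _ ≤ 1 / L * (PX x * √(γ * L)) + m2 + m2 := by
          gcongr
          · refine (sum_mul_abs_le_sqrt hw0 hw1 _).trans ?_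
            rw [sum_iid_mul_sq hA _ hg0]
            refine (Real.sqrt_le_sqrt (mul_le_mul_of_nonneg_left hg2 hL.le)).trans (le_of_eq ?_)
            rw [show L * (γ * PX x ^ 2) = PX x ^ 2 * (γ * L) by ring,
              Real.sqrt_mul (sq_nonneg _), Real.sqrt_sq (hPX0 x)]
          · simp only [sum_iid_mul hA _ V2, sum_const, card_univ, nsmul_eq_mul]
            apply le_of_eq
            change 1 / L * (L * m2) = m2
            field_simp
      _ = _ := by
          have h1 : √(γ * L) = L * √(γ / L) := by
            rw [show γ * L = L ^ 2 * (γ / L) by field_simp, Real.sqrt_mul (sq_nonneg _),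
              Real.sqrt_sq hL.le]
          rw [h1, hm2]
          simp only [V2, mul_assoc]
          field_simp
          ring
  calc _ = ∑ x, ∑ c : ι → A, (∏ i, PA (c i)) * |PX x - 1 / L * ∑ i, V (c i) x| := by
        simp only [mul_sum (s := (univ : Finset X))]
        exact sum_comm
    _ ≤ _ := sum_le_sum fun x _ => key x
    _ = _ := by
        rw [sum_add_distrib, ← sum_mul, hX, one_mul, ← mul_sum, sum_comm]

/-- One-shot Wyner-Ziv coding with `M` messages and an auxiliary bin size `K`. -/
theorem oneshot_wynerZiv {A X Y : Type*} [Fintype A] [Fintype X] [Fintype Y]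
    {PA : A → ℝ} (hA0 : ∀ a, 0 ≤ PA a) (hA : ∑ a, PA a = 1)
    {V : A → X → ℝ} (hV0 : ∀ a x, 0 ≤ V a x) {U : X → Y → ℝ} (hU0 : ∀ x y, 0 ≤ U x y)
    (hU1 : ∀ x, ∑ y, U x y ≤ 1) {PX : X → ℝ} (hPX : ∀ x, ∑ a, PA a * V a x = PX x)
    (hX : ∑ x, PX x = 1) {T : A → Y → ℝ} (hT : ∀ a y, ∑ x, V a x * U x y = T a y)
    {PY : Y → ℝ} (hPY : ∀ y, ∑ a, PA a * T a y = PY y)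
    {D : A → X → Y → ℝ} (hD0 : ∀ a x y, 0 ≤ D a x y) {B : ℝ} (hDB : ∀ a x y, D a x y ≤ B)
    (hB : 0 ≤ B) {M K : ℕ} (hM : 0 < M) (hK : 0 < K) {γ γ' : ℝ} (hγ : 0 ≤ γ) (hγ' : 0 < γ') :
    ∃ (φ : X → Fin M) (g : Fin M → Y → A),
      ∑ x, ∑ y, PX x * U x y * D (g (φ x) y) x y ≤
        ∑ a, ∑ x, ∑ y, PA a * V a x * U x y * D a x y +
        B * (√(γ / (M * K)) +
          2 * ∑ a, ∑ x, PA a * V a x * (if γ * PX x < V a x then 1 else 0) +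
          (∑ a, ∑ y, PA a * T a y * (if T a y ≤ γ' * PY y then 1 else 0) + (K - 1) / γ')) := by
  classical
  have : Nonempty (Fin M) := ⟨⟨0, hM⟩⟩
  have : Nonempty (Fin K) := ⟨⟨0, hK⟩⟩
  have hM' : (0 : ℝ) < M := by exact_mod_cast hM
  have hK' : (0 : ℝ) < K := by exact_mod_cast hK
  have hT0 : ∀ a y, 0 ≤ T a y := fun a y => hT a y ▸
    sum_nonneg fun _ _ => mul_nonneg (hV0 _ _) (hU0 _ _)
  have hT1 : ∀ a, ∑ y, T a y ≤ ∑ x, V a x := fun a => by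
    simp only [← hT]
    rw [sum_comm]
    refine sum_le_sum fun x _ => ?_
    rw [← mul_sum]
    exact mul_le_of_le_one_right (hV0 _ _) (hU1 x)
  have hAV : ∑ a, PA a * ∑ x, V a x = 1 := by
    simp only [mul_sum]
    rw [sum_comm, ← hX]
    exact sum_congr rfl fun x _ => hPX x
  have hAT : ∑ a, PA a * ∑ y, T a y ≤ 1 :=
    hAV ▸ sum_le_sum fun a _ => mul_le_mul_of_nonneg_left (hT1 a) (hA0 a)
  -- Codewords are drawn independently from `PA`. Only the first index is transmitted; the decoder
  -- recovers the position in the bin from `y`.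
  let w : (Fin M × Fin K → A) → ℝ := fun c => ∏ l, PA (c l)
  have hw0 : ∀ c, 0 ≤ w c := fun c => prod_nonneg fun _ _ => hA0 _
  have hw1 : ∑ c, w c = 1 := sum_iid hA
  let ind : A → Y → ℝ := fun a y => if T a y ≤ γ' * PY y then 1 else 0
  let ind' : A → Y → ℝ := fun a y => if γ' * PY y < T a y then 1 else 0
  have hi0 : ∀ a y, 0 ≤ ind a y := fun a y => by simp only [ind]; split_ifs <;> norm_num
  have hi'0 : ∀ a y, 0 ≤ ind' a y := fun a y => by simp only [ind']; split_ifs <;> norm_num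
  -- a threshold decoder
  have hdec : ∃ g : (Fin M × Fin K → A) → Fin M → Y → A, ∀ c m y,
      (∃ k, γ' * PY y < T (c (m, k)) y) →
        ∃ k, γ' * PY y < T (c (m, k)) y ∧ g c m y = c (m, k) := by
    refine ⟨fun c m y => if h : ∃ k, γ' * PY y < T (c (m, k)) y then c (m, h.choose)
      else c (m, ⟨0, hK⟩), fun c m y h => ⟨h.choose, h.choose_spec, ?_⟩⟩
    exact dif_pos h
  obtain ⟨g, hg⟩ := hdec
  -- The decoder can miss `c (m, k)` only if that codeword fails the threshold or another one in the
  -- bin passes it; either event costs at most `B`.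
  have hgD : ∀ c m k x y, D (g c m y) x y ≤ D (c (m, k)) x y +
      B * (ind (c (m, k)) y + ∑ k' ∈ univ.erase k, ind' (c (m, k')) y) := by
    intro c m k x y
    by_cases h1 : T (c (m, k)) y ≤ γ' * PY y
    · have h2 : 1 ≤ ind (c (m, k)) y + ∑ k' ∈ univ.erase k, ind' (c (m, k')) y := by
        have : ind (c (m, k)) y = 1 := if_pos h1
        linarith [sum_nonneg fun k' (_ : k' ∈ univ.erase k) => hi'0 (c (m, k')) y]
      nlinarith [hD0 (c (m, k)) x y, hDB (g c m y) x y, mul_le_mul_of_nonneg_left h2 hB]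
    · have h0 : 0 ≤ ∑ k' ∈ univ.erase k, ind' (c (m, k')) y := sum_nonneg fun _ _ => hi'0 _ _
      obtain ⟨k₁, hk₁, hgk⟩ := hg c m y ⟨k, not_le.1 h1⟩
      rw [hgk]
      rcases eq_or_ne k₁ k with rfl | hne
      · have := hi0 (c (m, k₁)) y
        nlinarith [mul_nonneg hB (add_nonneg this h0)]
      · have h2 : 1 ≤ ∑ k' ∈ univ.erase k, ind' (c (m, k')) y := by
          have h3 : ind' (c (m, k₁)) y = 1 := if_pos hk₁
          rw [← h3]
          exact single_le_sum (f := fun k' => ind' (c (m, k')) y) (fun k' _ => hi'0 _ _)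
            (mem_erase.2 ⟨hne, mem_univ _⟩)
        have := hi0 (c (m, k)) y
        nlinarith [hD0 (c (m, k)) x y, hDB (c (m, k₁)) x y,
          mul_le_mul_of_nonneg_left (h2.trans (le_add_of_nonneg_left this)) hB]
  -- the ideal distortion and the covering error of a codebook
  let J : (Fin M × Fin K → A) → ℝ := fun c =>
    1 / (M * K) * ∑ l, ∑ x, ∑ y, V (c l) x * U x y * D (g c l.1 y) x y
  let E : (Fin M × Fin K → A) → ℝ := fun c =>
    ∑ x, |PX x - 1 / (M * K) * ∑ l, V (c l) x|
  have hcode : ∀ c, ∃ φ : X → Fin M,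
      ∑ x, ∑ y, PX x * U x y * D (g c (φ x) y) x y ≤ J c + B * E c := by
    intro c
    let dist : X → Fin M → ℝ := fun x m => ∑ y, U x y * D (g c m y) x y
    have hd0 : ∀ x m, 0 ≤ dist x m := fun x m =>
      sum_nonneg fun _ _ => mul_nonneg (hU0 _ _) (hD0 _ _ _)
    have hdB : ∀ x m, dist x m ≤ B := fun x m => by
      calc dist x m ≤ ∑ y, U x y * B :=
            sum_le_sum fun y _ => mul_le_mul_of_nonneg_left (hDB _ _ _) (hU0 _ _)
        _ ≤ B := by rw [← sum_mul]; exact mul_le_of_le_one_left hB (hU1 x)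
    -- No randomized encoder is needed: the best message for `x` does at least as well as the
    -- likelihood-weighted average over codewords.
    choose φ hφ using fun x => Finite.exists_min (dist x)
    refine ⟨φ, ?_⟩
    have hJ : J c = ∑ x, 1 / (M * K) * ∑ l, V (c l) x * dist x l.1 := by
      simp only [J]
      rw [sum_comm, mul_sum]
      refine sum_congr rfl fun x _ => ?_
      simp only [dist, mul_sum (s := (univ : Finset Y)), mul_assoc]
    rw [hJ, mul_sum, ← sum_add_distrib]
    refine sum_le_sum fun x _ => ?_
    have e1 : ∑ y, PX x * U x y * D (g c (φ x) y) x y = PX x * dist x (φ x) := by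
      simp only [dist, mul_sum, mul_assoc]
    have e2 : 1 / (M * K) * (∑ l, V (c l) x) * dist x (φ x) ≤
        1 / (M * K) * ∑ l, V (c l) x * dist x l.1 := by
      rw [mul_assoc, sum_mul]
      refine mul_le_mul_of_nonneg_left (sum_le_sum fun l _ => ?_) (by positivity)
      exact mul_le_mul_of_nonneg_left (hφ x l.1) (hV0 _ _)
    have e3 : (PX x - 1 / (M * K) * ∑ l, V (c l) x) * dist x (φ x) ≤
        B * |PX x - 1 / (M * K) * ∑ l, V (c l) x| := by
      rw [mul_comm B]
      exact (mul_le_mul_of_nonneg_right (le_abs_self _) (hd0 _ _)).trans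
        (mul_le_mul_of_nonneg_left (hdB _ _) (abs_nonneg _))
    rw [e1]
    linarith
  have hEavg : ∑ c, w c * E c ≤ √(γ / (M * K)) +
      2 * ∑ a, ∑ x, PA a * V a x * (if γ * PX x < V a x then 1 else 0) := by
    have := soft_covering (ι := Fin M × Fin K) hA0 hA hV0 hPX hX hγ
    simpa only [Fintype.card_prod, Fintype.card_fin, Nat.cast_mul] using this
  have hJavg : ∑ c, w c * J c ≤ ∑ a, ∑ x, ∑ y, PA a * V a x * U x y * D a x y +
      B * (∑ a, ∑ y, PA a * T a y * ind a y + (K - 1) / γ') := by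
    set R := ∑ a, ∑ x, ∑ y, PA a * V a x * U x y * D a x y +
      B * (∑ a, ∑ y, PA a * T a y * ind a y + (K - 1) / γ') with hR
    have hl : ∀ l : Fin M × Fin K,
        ∑ c, w c * ∑ x, ∑ y, V (c l) x * U x y * D (g c l.1 y) x y ≤ R := by
      rintro ⟨m, k⟩
      have hVUT : ∀ (a : A) (S : Y → ℝ), ∑ x, ∑ y, V a x * U x y * (D a x y + B * S y) =
          ∑ x, ∑ y, V a x * U x y * D a x y + B * ∑ y, T a y * S y := by
        intro a S
        simp only [mul_add, sum_add_distrib]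
        congr 1
        rw [sum_comm, mul_sum]
        refine sum_congr rfl fun y _ => ?_
        rw [← hT, sum_mul, mul_sum]
        exact sum_congr rfl fun x _ => by ring
      have hpt : ∀ c : Fin M × Fin K → A,
          ∑ x, ∑ y, V (c (m, k)) x * U x y * D (g c m y) x y ≤
          ∑ x, ∑ y, V (c (m, k)) x * U x y * D (c (m, k)) x y +
          B * (∑ y, T (c (m, k)) y * ind (c (m, k)) y +
            ∑ k' ∈ univ.erase k, ∑ y, T (c (m, k)) y * ind' (c (m, k')) y) := by
        intro c
        calc _ ≤ ∑ x, ∑ y, V (c (m, k)) x * U x y * (D (c (m, k)) x y +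
              B * (ind (c (m, k)) y + ∑ k' ∈ univ.erase k, ind' (c (m, k')) y)) :=
              sum_le_sum fun x _ => sum_le_sum fun y _ =>
                mul_le_mul_of_nonneg_left (hgD c m k x y) (mul_nonneg (hV0 _ _) (hU0 _ _))
          _ = _ := by
              rw [hVUT]
              congr 2
              simp only [mul_add, sum_add_distrib, mul_sum (s := univ.erase k)]
              rw [sum_comm (t := univ.erase k)]
      -- Distinct codewords are independent, so averaging over the first replaces `T` by `PY`; the
      -- threshold then trades `PY y` for `T b y / γ'`.
      have hpair : ∀ k' ∈ univ.erase k,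
          ∑ c, w c * ∑ y, T (c (m, k)) y * ind' (c (m, k')) y ≤ 1 / γ' := by
        intro k' hk'
        have hne : ((m, k) : Fin M × Fin K) ≠ (m, k') := fun h =>
          (mem_erase.1 hk').1 (Prod.mk.inj h).2.symm
        calc _ = ∑ y, ∑ c, w c * (T (c (m, k)) y * ind' (c (m, k')) y) := by
              simp only [mul_sum]; exact sum_comm
          _ = ∑ y, PY y * ∑ b, PA b * ind' b y := by
              refine sum_congr rfl fun y _ => ?_
              rw [← hPY]
              exact sum_iid_mul_mul hA hne (fun a => T a y) fun b => ind' b y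
          _ ≤ ∑ y, ∑ b, PA b * T b y / γ' := by
              refine sum_le_sum fun y _ => ?_
              rw [mul_sum]
              refine sum_le_sum fun b _ => ?_
              simp only [ind']
              split_ifs with h
              · rw [le_div_iff₀ hγ']
                nlinarith [mul_le_mul_of_nonneg_left h.le (hA0 b)]
              · rw [mul_zero, mul_zero]
                exact div_nonneg (mul_nonneg (hA0 _) (hT0 _ _)) hγ'.le
          _ ≤ 1 / γ' := by
              rw [sum_comm]
              simp only [← sum_div, ← mul_sum]
              gcongr
      calc _ ≤ ∑ c, w c * (∑ x, ∑ y, V (c (m, k)) x * U x y * D (c (m, k)) x y +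
            B * (∑ y, T (c (m, k)) y * ind (c (m, k)) y +
            ∑ k' ∈ univ.erase k, ∑ y, T (c (m, k)) y * ind' (c (m, k')) y)) :=
            sum_le_sum fun c _ => mul_le_mul_of_nonneg_left (hpt c) (hw0 c)
        _ = ∑ c, w c * (∑ x, ∑ y, V (c (m, k)) x * U x y * D (c (m, k)) x y) +
            B * (∑ c, w c * (∑ y, T (c (m, k)) y * ind (c (m, k)) y) +
            ∑ k' ∈ univ.erase k, ∑ c, w c * ∑ y, T (c (m, k)) y * ind' (c (m, k')) y) := by
            rw [sum_comm (s := univ.erase k)]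
            simp only [← mul_sum (s := univ.erase k)]
            rw [← sum_add_distrib, mul_sum (a := B), ← sum_add_distrib]
            exact sum_congr rfl fun c _ => by ring
        _ ≤ ∑ a, PA a * (∑ x, ∑ y, V a x * U x y * D a x y) +
            B * (∑ a, PA a * (∑ y, T a y * ind a y) + ∑ k' ∈ univ.erase k, 1 / γ') := by
            have h1 := sum_iid_mul hA (m, k) fun a => ∑ x, ∑ y, V a x * U x y * D a x y
            have h2 := sum_iid_mul hA (m, k) fun a => ∑ y, T a y * ind a y
            refine add_le_add h1.le (mul_le_mul_of_nonneg_left (add_le_add h2.le ?_) hB)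
            exact sum_le_sum hpair
        _ = R := by
            rw [hR, sum_const, card_erase_of_mem (mem_univ k), card_univ, Fintype.card_fin,
              nsmul_eq_mul, Nat.cast_sub hK, Nat.cast_one, mul_one_div]
            simp only [mul_sum, mul_assoc]
    calc _ = 1 / (M * K) * ∑ l : Fin M × Fin K,
          ∑ c, w c * ∑ x, ∑ y, V (c l) x * U x y * D (g c l.1 y) x y := by
          rw [sum_comm, mul_sum]
          refine sum_congr rfl fun c _ => ?_
          simp only [J]
          rw [← mul_sum]
          ring
      _ ≤ 1 / (M * K) * ∑ l : Fin M × Fin K, R := by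
          gcongr with l _
          exact hl l
      _ = R := by
          simp only [sum_const, card_univ, Fintype.card_prod, Fintype.card_fin, nsmul_eq_mul,
            Nat.cast_mul]
          field_simp
  -- Some codebook is no worse than average. It must have positive weight so that `w c` can be
  -- cancelled.
  obtain ⟨c, -, hc⟩ : ∃ c ∈ (univ : Finset (Fin M × Fin K → A)), w c * (J c + B * E c) ≤
      w c * (∑ c, w c * (J c + B * E c)) ∧ 0 < w c := by
    by_contra! hcon
    have h1 : ∀ c, w c * (∑ c, w c * (J c + B * E c)) ≤ w c * (J c + B * E c) := fun c => by
      rcases (hw0 c).eq_or_lt with h | h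
      · simp [← h]
      · by_contra! h'
        exact absurd (hcon c (mem_univ c) h'.le) (not_le.2 h)
    obtain ⟨c, -, hc⟩ : ∃ c ∈ univ, 0 < w c := by
      by_contra! h
      linarith [sum_nonpos h]
    have h2 : w c * (∑ c, w c * (J c + B * E c)) < w c * (J c + B * E c) := by
      by_contra! h'
      exact absurd (hcon c (mem_univ c) h') (not_le.2 hc)
    have h3 := sum_lt_sum (fun c _ => h1 c) ⟨c, mem_univ c, h2⟩
    rw [← sum_mul, hw1, one_mul] at h3
    exact h3.false
  obtain ⟨φ, hφ⟩ := hcode c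
  refine ⟨φ, g c, hφ.trans ((le_of_mul_le_mul_left hc.1 hc.2).trans ?_)⟩
  have e : ∑ c, w c * (J c + B * E c) = ∑ c, w c * J c + B * ∑ c, w c * E c := by
    rw [mul_sum, ← sum_add_distrib]
    exact sum_congr rfl fun c _ => by ring
  rw [e]
  nlinarith [mul_le_mul_of_nonneg_left hEavg hB]

/-! ### Wyner-Ziv coding for iid sources -/

/-- Concentration of the information density. -/
theorem infoDensity_concentration {A X : Type*} [Fintype A] [Fintype X] {PA : A → ℝ}
    (hA0 : ∀ a, 0 ≤ PA a) {V : A → X → ℝ} (hV0 : ∀ a x, 0 ≤ V a x) {PX : X → ℝ}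
    (hPX : ∀ x, ∑ a, PA a * V a x = PX x) (hX : ∑ x, PX x = 1) {μ : ℝ}
    (hμ : ∑ a, ∑ x, PA a * V a x * Real.logb 2 (V a x / PX x) = μ) :
    ∃ C : ℝ, ∀ n : ℕ, 0 < n → ∀ η : ℝ, 0 < η →
      ∑ a : Fin n → A, ∑ x : Fin n → X, (∏ i, PA (a i)) * (∏ i, V (a i) (x i)) *
        (if (2 : ℝ) ^ (n * (μ + η)) * ∏ i, PX (x i) < ∏ i, V (a i) (x i) then 1 else 0) ≤
          C / (n * η ^ 2) ∧
      ∑ a : Fin n → A, ∑ x : Fin n → X, (∏ i, PA (a i)) * (∏ i, V (a i) (x i)) *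
        (if ∏ i, V (a i) (x i) ≤ (2 : ℝ) ^ (n * (μ - η)) * ∏ i, PX (x i) then 1 else 0) ≤
          C / (n * η ^ 2) := by
  let r : A × X → ℝ := fun s => PA s.1 * V s.1 s.2
  let f : A × X → ℝ := fun s => Real.logb 2 (V s.1 s.2 / PX s.2)
  have hr0 : ∀ s, 0 ≤ r s := fun s => mul_nonneg (hA0 _) (hV0 _ _)
  have hr1 : ∑ s, r s = 1 := by
    rw [Fintype.sum_prod_type, sum_comm]
    exact (sum_congr rfl fun x _ => hPX x).trans hX
  have hf : ∑ s, r s * f s = μ := by rw [Fintype.sum_prod_type]; exact hμ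
  have hpos : ∀ s, 0 < r s → 0 < V s.1 s.2 ∧ 0 < PX s.2 := fun s hs =>
    ⟨(hV0 _ _).lt_of_ne fun h => by simp only [r, ← h, mul_zero, lt_irrefl] at hs,
      hPX s.2 ▸ sum_pos' (fun _ _ => mul_nonneg (hA0 _) (hV0 _ _)) ⟨s.1, mem_univ _, hs⟩⟩
  have hlog : ∀ {n : ℕ} (c : Fin n → A × X), (∀ i, 0 < r (c i)) →
      ∑ i, f (c i) = Real.logb 2 ((∏ i, V (c i).1 (c i).2) / ∏ i, PX (c i).2) := by
    intro n c hc
    rw [← prod_div_distrib, Real.logb_prod]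
    exact fun i _ => (div_pos (hpos _ (hc i)).1 (hpos _ (hc i)).2).ne'
  -- The constant is the single-letter variance of the information density, independent of `n` and
  -- `η`.
  refine ⟨∑ s, r s * (f s - ∑ s, r s * f s) ^ 2, fun n hn η hη => ⟨?_, ?_⟩⟩
  · rw [sum_pair_pi]
    have := sum_iid_indicator_le hr0 hr1 f hη hn (fun c => (2 : ℝ) ^ (n * (μ + η)) *
      ∏ i, PX (c i).2 < ∏ i, V (c i).1 (c i).2) (fun c hc hc0 => ?_)
    · simpa only [r, prod_mul_distrib] using this
    · have h1 : 0 < ∏ i, PX (c i).2 := prod_pos fun i _ => (hpos _ (hc0 i)).2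
      have h2 : 0 < ∏ i, V (c i).1 (c i).2 := prod_pos fun i _ => (hpos _ (hc0 i)).1
      rw [hf, hlog c hc0]
      rw [← lt_div_iff₀ h1, ← Real.lt_logb_iff_rpow_lt one_lt_two (div_pos h2 h1)] at hc
      refine le_trans ?_ (le_abs_self _)
      linarith
  · rw [sum_pair_pi]
    have := sum_iid_indicator_le hr0 hr1 f hη hn (fun c => ∏ i, V (c i).1 (c i).2 ≤
      (2 : ℝ) ^ (n * (μ - η)) * ∏ i, PX (c i).2) (fun c hc hc0 => ?_)
    · simpa only [r, prod_mul_distrib] using this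
    · have h1 : 0 < ∏ i, PX (c i).2 := prod_pos fun i _ => (hpos _ (hc0 i)).2
      have h2 : 0 < ∏ i, V (c i).1 (c i).2 := prod_pos fun i _ => (hpos _ (hc0 i)).1
      rw [hf, hlog c hc0]
      rw [← div_le_iff₀ h1, ← Real.logb_le_iff_le_rpow one_lt_two (div_pos h2 h1)] at hc
      refine le_trans ?_ (neg_le_abs _)
      linarith

theorem tendsto_wynerZiv_error (B C₁ C₂ : ℝ) {η : ℝ} (hη : 0 < η) :
    Filter.Tendsto (fun n : ℕ => B * (√((2 : ℝ) ^ (-(n * η))) + 2 * (C₁ / (n * η ^ 2)) +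
      (C₂ / (n * η ^ 2) + (2 : ℝ) ^ (-(n * η))))) Filter.atTop (nhds 0) := by
  have h1 : Filter.Tendsto (fun n : ℕ => (2 : ℝ) ^ (-(n * η))) Filter.atTop (nhds 0) := by
    have e : ∀ n : ℕ, (2 : ℝ) ^ (-(n * η)) = ((2 : ℝ) ^ (-η)) ^ n := fun n => by
      rw [← Real.rpow_natCast, ← Real.rpow_mul (by norm_num)]
      congr 1
      ring
    simp only [e]
    exact tendsto_pow_atTop_nhds_zero_of_lt_one (by positivity)
      (Real.rpow_lt_one_of_one_lt_of_neg one_lt_two (neg_neg_of_pos hη))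
  have h2 : ∀ C : ℝ, Filter.Tendsto (fun n : ℕ => C / (n * η ^ 2)) Filter.atTop (nhds 0) :=
    fun C => Filter.Tendsto.const_div_atTop
      (tendsto_natCast_atTop_atTop.atTop_mul_const (by positivity)) C
  have h3 := (Real.continuous_sqrt.tendsto 0).comp h1
  rw [Real.sqrt_zero] at h3
  simpa using ((h3.add ((h2 C₁).const_mul 2)).add ((h2 C₂).add h1)).const_mul B

/-- The one-shot bound on blocks. Covering needs `M * K` above `2 ^ (n I(X;A))` and decoding needs
`K` below `2 ^ (n I(Y;A))`; the quotient is the Wyner-Ziv rate. -/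
theorem exists_wynerZiv_code {A X Y Xh : Type*} [Fintype A] [Fintype X] [Fintype Y] [Fintype Xh]
    {q : X × Y → ℝ} (hq : q ∈ stdSimplex ℝ (X × Y)) {δ : X → Xh → ℝ}
    (hδ : ∀ x xh, 0 ≤ δ x xh) {d : ℝ} {p : A → X → Y → ℝ} (hp : ∀ a x y, 0 ≤ p a x y)
    (hpq : ∀ x y, ∑ a, p a x y = q (x, y))
    (hM : ∀ a x y, p a x y * (∑ a', ∑ y', p a' x y') = (∑ y', p a x y') * (∑ a', p a' x y))
    (π : A → Y → Xh) (hd : ∑ a, ∑ x, ∑ y, p a x y * δ x (π a y) ≤ d) {ε : ℝ} (hε : 0 < ε) :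
    ∃ N : ℕ, ∀ n ≥ N, ∀ M : ℕ,
      (2 : ℝ) ^ (n * (condMutualInfo (fun x a y => p a x y) + ε)) ≤ M →
      ∃ (φ : (Fin n → X) → Fin M) (g : Fin M → (Fin n → Y) → Fin n → Xh),
        ∑ x : Fin n → X, ∑ y : Fin n → Y, (∏ i, q (x i, y i)) *
          ((1 / (n : ℝ)) * ∑ i, δ (x i) (g (φ x) y i)) ≤ d + ε := by
  classical
  let PA : A → ℝ := fun a => ∑ x, ∑ y, p a x y
  let V : A → X → ℝ := fun a x => (∑ y, p a x y) / PA a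
  let PX : X → ℝ := fun x => ∑ y, q (x, y)
  let U : X → Y → ℝ := fun x y => q (x, y) / PX x
  let T : A → Y → ℝ := fun a y => ∑ x, V a x * U x y
  let PY : Y → ℝ := fun y => ∑ x, q (x, y)
  have hA0 : ∀ a, 0 ≤ PA a := fun a => sum_nonneg fun _ _ => sum_nonneg fun _ _ => hp _ _ _
  have hV0 : ∀ a x, 0 ≤ V a x := fun a x => div_nonneg (sum_nonneg fun _ _ => hp _ _ _) (hA0 a)
  have hX0 : ∀ x, 0 ≤ PX x := fun x => sum_nonneg fun _ _ => hq.1 _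
  have hU0 : ∀ x y, 0 ≤ U x y := fun x y => div_nonneg (hq.1 _) (hX0 x)
  have hT0 : ∀ a y, 0 ≤ T a y := fun a y => sum_nonneg fun _ _ => mul_nonneg (hV0 _ _) (hU0 _ _)
  have hU1 : ∀ x, ∑ y, U x y ≤ 1 := fun x => by
    simp only [U, ← sum_div]
    exact div_self_le_one _
  have hX1 : ∑ x, PX x = 1 := (Fintype.sum_prod_type' fun x y => q (x, y)).symm.trans hq.2
  have hY1 : ∑ y, PY y = 1 := by
    simp only [PY]
    rw [sum_comm]
    exact hX1
  -- Conditionals are 0 where the conditioning event has probability 0, so they are only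
  -- substochastic; weighted by that probability they still recover the joint law.
  have hAV : ∀ a x, PA a * V a x = ∑ y, p a x y := fun a x =>
    mul_div_cancel_of_imp' fun h => (sum_eq_zero_iff_of_nonneg fun _ _ =>
      sum_nonneg fun _ _ => hp _ _ _).1 h x (mem_univ _)
  have hPX' : ∀ x, ∑ a, ∑ y, p a x y = PX x := fun x => by
    rw [sum_comm]
    exact sum_congr rfl fun y _ => hpq x y
  have hPX : ∀ x, ∑ a, PA a * V a x = PX x := fun x => by simp only [hAV, hPX']
  have hA1 : ∑ a, PA a = 1 := by
    simp only [PA]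
    rw [sum_comm, ← hX1]
    exact sum_congr rfl fun x _ => hPX' x
  have hXU : ∀ x y, PX x * U x y = q (x, y) := fun x y =>
    mul_div_cancel_of_imp' fun h => (sum_eq_zero_iff_of_nonneg fun _ _ => hq.1 _).1 h y (mem_univ _)
  -- The only use of the Markov chain `A - X - Y`.
  have hAVU : ∀ a x y, PA a * V a x * U x y = p a x y := fun a x y => by
    have h1 := hM a x y
    rw [hPX', hpq, ← hXU] at h1
    rw [hAV]
    rcases (hX0 x).eq_or_lt with h | h
    · have h2 : p a x y = 0 := by
        have h3 : q (x, y) = 0 := by rw [← hXU, ← h, zero_mul]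
        rw [← hpq, sum_eq_zero_iff_of_nonneg fun _ _ => hp _ _ _] at h3
        exact h3 a (mem_univ _)
      simp only [U, ← h, div_zero, mul_zero, h2]
    · refine mul_right_cancel₀ h.ne' ?_
      rw [h1]
      ring
  have hAT : ∀ a y, PA a * T a y = ∑ x, p a x y := fun a y => by
    simp only [T, mul_sum, ← hAVU, mul_assoc]
  have hPY : ∀ y, ∑ a, PA a * T a y = PY y := fun y => by
    simp only [hAT]
    rw [sum_comm]
    exact sum_congr rfl fun x _ => hpq x y
  set I₁ := ∑ a, ∑ x, PA a * V a x * Real.logb 2 (V a x / PX x) with hI₁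
  set I₂ := ∑ a, ∑ y, PA a * T a y * Real.logb 2 (T a y / PY y) with hI₂
  have hI : condMutualInfo (fun x a y => p a x y) = I₁ - I₂ := by
    have e1 : I₁ = ∑ x, ∑ a, ∑ y, p a x y * Real.logb 2 (V a x / PX x) := by
      rw [hI₁, sum_comm]
      simp only [hAV, sum_mul]
    have e2 : I₂ = ∑ x, ∑ a, ∑ y, p a x y * Real.logb 2 (T a y / PY y) := by
      rw [sum_comm, hI₂]
      refine sum_congr rfl fun a _ => ?_
      rw [sum_comm]
      simp only [hAT, sum_mul]
    rw [e1, e2, condMutualInfo]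
    simp only [← sum_sub_distrib]
    refine sum_congr rfl fun x _ => sum_congr rfl fun a _ => sum_congr rfl fun y _ => ?_
    rcases (hp a x y).eq_or_lt with h | h
    · simp [← h]
    · have h0 : 0 < PA a * V a x * U x y := by rwa [hAVU]
      have hu : 0 < U x y := (hU0 _ _).lt_of_ne fun h' => by simp [← h'] at h0
      have hv : 0 < V a x := (hV0 _ _).lt_of_ne fun h' => by simp [← h'] at h0
      have ha : 0 < PA a := (hA0 _).lt_of_ne fun h' => by simp [← h'] at h0
      have hx : 0 < PX x := (hX0 _).lt_of_ne fun h' => by simp [U, ← h'] at hu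
      have ht : 0 < T a y :=
        sum_pos' (fun _ _ => mul_nonneg (hV0 _ _) (hU0 _ _)) ⟨x, mem_univ _, mul_pos hv hu⟩
      have hy : 0 < PY y := hPY y ▸
        sum_pos' (fun _ _ => mul_nonneg (hA0 _) (hT0 _ _)) ⟨a, mem_univ _, mul_pos ha ht⟩
      rw [← mul_sub, ← Real.logb_div (by positivity) (by positivity), hpq, ← hAT, ← hXU, ← hAVU]
      have h4 : ∑ x, ∑ a, p a x y = PY y := by simp only [hpq, PY]
      rw [h4]
      congr 2
      field_simp
  obtain ⟨B, hB0, hB⟩ : ∃ B : ℝ, 0 ≤ B ∧ ∀ x xh, δ x xh ≤ B :=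
    ⟨∑ x, ∑ xh, δ x xh, sum_nonneg fun _ _ => sum_nonneg fun _ _ => hδ _ _, fun x xh =>
      (single_le_sum (f := fun xh => δ x xh) (fun _ _ => hδ _ _) (mem_univ xh)).trans
      (single_le_sum (f := fun x => ∑ xh, δ x xh) (fun _ _ => sum_nonneg fun _ _ => hδ _ _)
        (mem_univ x))⟩
  obtain ⟨C₁, hC₁⟩ := infoDensity_concentration hA0 hV0 hPX hX1 hI₁.symm
  obtain ⟨C₂, hC₂⟩ := infoDensity_concentration hA0 hT0 hPY hY1 hI₂.symm
  let η := ε / 4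
  have hη : 0 < η := by positivity
  obtain ⟨N, hN⟩ := Filter.eventually_atTop.1 (((tendsto_wynerZiv_error B C₁ C₂ hη).eventually
    (gt_mem_nhds hε)).and (Filter.eventually_gt_atTop 0))
  refine ⟨N, fun n hn M hMn => ?_⟩
  obtain ⟨hNε, hn0⟩ := hN n hn
  have hn' : (0 : ℝ) < n := by exact_mod_cast hn0
  rw [hI] at hMn
  have hM0 : 0 < M := by
    have : (0 : ℝ) < M := lt_of_lt_of_le (by positivity) hMn
    exact_mod_cast this
  have hM' : (0 : ℝ) < M := by exact_mod_cast hM0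
  -- Since `ε = 4 * η`, this gives `M * K ≥ 2 ^ (n * (I₁ + 2 * η))`. Hence `γ / (M * K)` and `(K -
  -- 1) / γ'` are both at most `2 ^ (-(n * η))`; having `K - 1` there absorbs the rounding.
  let K := ⌈(2 : ℝ) ^ (n * (I₂ - 2 * η))⌉₊
  have hK0 : 0 < K := Nat.ceil_pos.2 (by positivity)
  have hKle : (2 : ℝ) ^ (n * (I₂ - 2 * η)) ≤ K := Nat.le_ceil _
  have hKge : (K : ℝ) - 1 ≤ (2 : ℝ) ^ (n * (I₂ - 2 * η)) := by
    linarith [Nat.ceil_lt_add_one (by positivity : 0 ≤ (2 : ℝ) ^ (n * (I₂ - 2 * η)))]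
  obtain ⟨φ, g, hφ⟩ := oneshot_wynerZiv (PA := fun a : Fin n → A => ∏ i, PA (a i))
    (fun a => prod_nonneg fun _ _ => hA0 _) (sum_iid hA1)
    (V := fun a x => ∏ i, V (a i) (x i)) (fun a x => prod_nonneg fun _ _ => hV0 _ _)
    (U := fun (x : Fin n → X) (y : Fin n → Y) => ∏ i, U (x i) (y i))
    (fun x y => prod_nonneg fun _ _ => hU0 _ _)
    (fun x => by
      rw [sum_prod_apply fun i => U (x i)]
      exact prod_le_one (fun _ _ => sum_nonneg fun _ _ => hU0 _ _) fun _ _ => hU1 _)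
    (PX := fun x => ∏ i, PX (x i))
    (fun x => by
      simp only [← prod_mul_distrib]
      rw [sum_prod_apply fun i a => PA a * V a (x i)]
      simp only [hPX])
    (sum_iid hX1)
    (T := fun a y => ∏ i, T (a i) (y i))
    (fun a y => by
      simp only [← prod_mul_distrib]
      rw [sum_prod_apply fun i x => V (a i) x * U x (y i)])
    (PY := fun y => ∏ i, PY (y i))
    (fun y => by
      simp only [← prod_mul_distrib]
      rw [sum_prod_apply fun i a => PA a * T a (y i)]
      simp only [hPY])
    (D := fun a x y => 1 / (n : ℝ) * ∑ i, δ (x i) (π (a i) (y i)))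
    (fun a x y => mul_nonneg (by positivity) (sum_nonneg fun _ _ => hδ _ _)) (B := B)
    (fun a x y => by
      rw [one_div_mul_eq_div, div_le_iff₀ hn']
      refine (sum_le_sum fun i _ => hB (x i) (π (a i) (y i))).trans (le_of_eq ?_)
      rw [sum_const, card_univ, Fintype.card_fin, nsmul_eq_mul, mul_comm])
    hB0 hM0 hK0 (γ := (2 : ℝ) ^ (n * (I₁ + η))) (γ' := (2 : ℝ) ^ (n * (I₂ - η)))
    (by positivity) (by positivity)
  refine ⟨φ, fun m y i => π (g m y i) (y i), ?_⟩
  simp only [← prod_mul_distrib, hXU] at hφ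
  refine hφ.trans (add_le_add ?_ (le_trans (mul_le_mul_of_nonneg_left ?_ hB0) hNε.le))
  · refine le_trans (le_of_eq ?_) hd
    have hp1 : ∑ s : A × X × Y, p s.1 s.2.1 s.2.2 = 1 := by
      simpa only [Fintype.sum_prod_type] using hA1
    have e : ∀ a : Fin n → A, ∑ x : Fin n → X, ∑ y : Fin n → Y,
        (∏ i, PA (a i) * V (a i) (x i) * U (x i) (y i)) *
          (1 / (n : ℝ) * ∑ i, δ (x i) (π (a i) (y i))) =
        ∑ c : Fin n → X × Y, (∏ i, p (a i) (c i).1 (c i).2) *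
          (1 / (n : ℝ) * ∑ i, δ (c i).1 (π (a i) (c i).2)) := fun a => by
      simp only [hAVU]
      exact sum_pair_pi fun x y => (∏ i, p (a i) (x i) (y i)) *
          (1 / (n : ℝ) * ∑ i, δ (x i) (π (a i) (y i)))
    simp only [e]
    rw [sum_pair_pi]
    have h1 := fun i : Fin n => sum_iid_mul hp1 i fun s => δ s.2.1 (π s.1 s.2.2)
    simp only [mul_left_comm _ (1 / (n : ℝ))]
    rw [← mul_sum]
    simp only [mul_sum (s := (univ : Finset (Fin n)))]
    rw [sum_comm, sum_congr rfl fun i _ => h1 i]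
    simp only [sum_const, card_univ, Fintype.card_fin, nsmul_eq_mul, Fintype.sum_prod_type]
    field_simp
  · have h1 := (hC₁ n hn0 η hη).1
    have h2 := (hC₂ n hn0 η hη).2
    simp only [← prod_mul_distrib] at h1 h2
    refine add_le_add (add_le_add (Real.sqrt_le_sqrt ?_) (mul_le_mul_of_nonneg_left h1 zero_le_two))
      (add_le_add h2 ?_)
    · rw [div_le_iff₀ (by positivity)]
      calc (2 : ℝ) ^ (n * (I₁ + η)) = (2 : ℝ) ^ (-(n * η)) *
            ((2 : ℝ) ^ (n * (I₁ - I₂ + ε)) * (2 : ℝ) ^ (n * (I₂ - 2 * η))) := by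
            rw [← Real.rpow_add two_pos, ← Real.rpow_add two_pos]
            congr 1
            simp only [η]
            ring
        _ ≤ _ := by gcongr
    · rw [div_le_iff₀ (by positivity), ← Real.rpow_add two_pos]
      refine hKge.trans (le_of_eq ?_)
      congr 1
      ring

/-! ### The compress-linear bound -/

theorem wzRD_nonneg {X Y Xh : Type*} [Fintype X] [Fintype Y] (q : X × Y → ℝ) (δ : X → Xh → ℝ)
    (d : ℝ) : 0 ≤ wzRD q δ d := by
  refine Real.sInf_nonneg ?_
  rintro _ ⟨k, -, p, hp, -, -, -, rfl⟩
  exact condMutualInfo_nonneg fun _ _ _ => hp _ _ _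

theorem exists_wynerZiv_code_of_wzRD {X Y Xh : Type*} [Fintype X] [Fintype Y] [Fintype Xh]
    {q : X × Y → ℝ} (hq : q ∈ stdSimplex ℝ (X × Y)) {δ : X → Xh → ℝ}
    (hδ : IsNormalDistortion δ) {d : ℝ} (hd : 0 ≤ d) {ε : ℝ} (hε : 0 < ε) :
    ∃ N : ℕ, ∀ n ≥ N, ∀ M : ℕ, (2 : ℝ) ^ (n * (wzRD q δ d + 2 * ε)) ≤ M →
      ∃ (φ : (Fin n → X) → Fin M) (g : Fin M → (Fin n → Y) → Fin n → Xh),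
        ∑ x : Fin n → X, ∑ y : Fin n → Y, (∏ i, q (x i, y i)) *
          ((1 / (n : ℝ)) * ∑ i, δ (x i) (g (φ x) y i)) ≤ d + ε := by
  classical
  obtain ⟨r, ⟨k, -, p, hp, hpq, hM, ⟨π, hπ⟩, rfl⟩, hr⟩ := exists_lt_of_csInf_lt
    (s := {r : ℝ | ∃ k : ℕ, k ≤ Fintype.card X + 1 ∧ ∃ p : Fin k → X → Y → ℝ,
      (∀ a x y, 0 ≤ p a x y) ∧ (∀ x y, ∑ a, p a x y = q (x, y)) ∧
      (∀ a x y, p a x y * (∑ a', ∑ y', p a' x y') = (∑ y', p a x y') * (∑ a', p a' x y)) ∧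
      (∃ π : Fin k → Y → Xh, ∑ a, ∑ x, ∑ y, p a x y * δ x (π a y) ≤ d) ∧
      r = condMutualInfo (fun x a y => p a x y)}) (b := wzRD q δ d + ε) (by
    -- The choice `A = X`, decoded without distortion by normality, shows that the infimum is over a
    -- nonempty set.
    let e : Fin (Fintype.card X) ≃ X := (Fintype.equivFin X).symm
    choose g hg using hδ.normal
    have hs : ∀ x y, ∑ a, (if e a = x then q (x, y) else 0) = q (x, y) := fun x y => by
      rw [e.sum_comp fun z => if z = x then q (x, y) else 0]
      simp
    refine ⟨_, _, Nat.le_succ _, fun a x y => if e a = x then q (x, y) else 0,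
      fun a x y => ?_, hs, fun a x y => ?_, ⟨fun a _ => g (e a), ?_⟩, rfl⟩
    · beta_reduce
      split_ifs
      exacts [hq.1 _, le_rfl]
    · rw [sum_comm]
      simp only [hs]
      split_ifs
      · ring
      · simp
    · refine (sum_eq_zero fun a _ => sum_eq_zero fun x _ => sum_eq_zero fun y _ => ?_).trans_le hd
      beta_reduce
      split_ifs with h
      · rw [← h, hg, mul_zero]
      · rw [zero_mul]) (lt_add_of_pos_right _ hε)
  obtain ⟨N, hN⟩ := exists_wynerZiv_code hq hδ.nonneg hp hpq hM π hπ hε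
  refine ⟨N, fun n hn M hMn => hN n hn M (le_trans ?_ hMn)⟩
  refine Real.rpow_le_rpow_of_exponent_le one_le_two (mul_le_mul_of_nonneg_left ?_ n.cast_nonneg)
  linarith

theorem swap_mem_stdSimplex {X Y : Type*} [Fintype X] [Fintype Y] {q : X × Y → ℝ}
    (hq : q ∈ stdSimplex ℝ (X × Y)) : q ∘ Prod.swap ∈ stdSimplex ℝ (Y × X) :=
  ⟨fun _ => hq.1 _, ((Equiv.prodComm Y X).sum_comp q).trans hq.2⟩

theorem achievable_compressLinearBound {X Y Xh Yh : Type*} [Fintype X] [Fintype Y] [Fintype Xh]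
    [Fintype Yh] {q : X × Y → ℝ} (hq : q ∈ stdSimplex ℝ (X × Y)) {δ₁ : X → Xh → ℝ}
    {δ₂ : Y → Yh → ℝ} (hδ₁ : IsNormalDistortion δ₁) (hδ₂ : IsNormalDistortion δ₂) {d₁ d₂ : ℝ}
    (hd₁ : 0 ≤ d₁) (hd₂ : 0 ≤ d₂) :
    Achievable q δ₁ δ₂ d₁ d₂ (compressLinearBound q δ₁ δ₂ d₁ d₂) := by
  have hm0 : 0 ≤ compressLinearBound q δ₁ δ₂ d₁ d₂ := le_max_of_le_left (wzRD_nonneg _ _ _)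
  refine ⟨hm0, fun ε hε n₀ => ?_⟩
  have hε4 : 0 < ε / 4 := by positivity
  obtain ⟨N₁, hN₁⟩ := exists_wynerZiv_code_of_wzRD hq hδ₁ hd₁ hε4
  obtain ⟨N₂, hN₂⟩ := exists_wynerZiv_code_of_wzRD (swap_mem_stdSimplex hq) hδ₂ hd₂ hε4
  -- Rounding `M` up costs at most one bit per block, which is at most `ε / 2` per symbol once `n ≥
  -- 2 / ε`.
  obtain ⟨N₃, hN₃⟩ := exists_nat_gt (2 / ε)
  have hwz₁ : wzRD q δ₁ d₁ ≤ compressLinearBound q δ₁ δ₂ d₁ d₂ := le_max_left _ _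
  have hwz₂ : wzRD (q ∘ Prod.swap) δ₂ d₂ ≤ compressLinearBound q δ₁ δ₂ d₁ d₂ := le_max_right _ _
  set m := compressLinearBound q δ₁ δ₂ d₁ d₂
  let n := N₁ + N₂ + N₃ + n₀ + 1
  have hn0 : (0 : ℝ) < n := by positivity
  let M := ⌈(2 : ℝ) ^ (n * (m + ε / 2))⌉₊
  have hMle : (2 : ℝ) ^ (n * (m + ε / 2)) ≤ M := Nat.le_ceil _
  have hexp : ∀ r, r ≤ m → (2 : ℝ) ^ (n * (r + 2 * (ε / 4))) ≤ M := fun r hr => by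
    refine le_trans (Real.rpow_le_rpow_of_exponent_le one_le_two
      (mul_le_mul_of_nonneg_left ?_ hn0.le)) hMle
    linarith
  have hMpos : (0 : ℝ) < M := lt_of_lt_of_le (by positivity) hMle
  have : NeZero M := ⟨by exact_mod_cast hMpos.ne'⟩
  obtain ⟨φ₁, g₁, h₁⟩ := hN₁ n (by omega) M (hexp _ hwz₁)
  obtain ⟨φ₂, g₂, h₂⟩ := hN₂ n (by omega) M (hexp _ hwz₂)
  -- Addition in `Fin M` is cyclic, so the sum needs no more messages than either summand.
  refine ⟨n, by omega, ⟨M, fun x y => φ₁ x + φ₂ y, fun s y => g₁ (s - φ₂ y) y,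
    fun s x => g₂ (s - φ₁ x) x⟩, ?_, ?_, ?_⟩
  · have hM2 : (M : ℝ) ≤ 2 ^ (1 + n * (m + ε / 2)) := by
      have h1 : (1 : ℝ) ≤ 2 ^ (n * (m + ε / 2)) :=
        Real.one_le_rpow one_le_two (by positivity)
      have h3 := Nat.ceil_lt_add_one (by positivity : 0 ≤ (2 : ℝ) ^ (n * (m + ε / 2)))
      rw [Real.rpow_add two_pos, Real.rpow_one]
      linarith
    have hlog : Real.logb 2 M ≤ 1 + n * (m + ε / 2) :=
      (Real.logb_le_iff_le_rpow one_lt_two hMpos).2 hM2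
    have hnε : 2 / ε ≤ n := hN₃.le.trans (by exact_mod_cast (by omega : N₃ ≤ n))
    rw [div_le_iff₀ hε] at hnε
    change Real.logb 2 M / n ≤ m + ε
    rw [div_le_iff₀ hn0]
    linarith
  · simp only [RDCode.dist₁, add_sub_cancel_right]
    linarith
  · simp only [RDCode.dist₂, add_sub_cancel_left]
    rw [sum_comm]
    exact h₂.trans (by linarith)

theorem cutSetBound_le_of_achievable {X Y Xh Yh : Type*} [Fintype X] [Fintype Y] [Fintype Xh]
    [Fintype Yh] {q : X × Y → ℝ} (hq : q ∈ stdSimplex ℝ (X × Y)) {δ₁ : X → Xh → ℝ}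
    {δ₂ : Y → Yh → ℝ} (hδ₁ : IsNormalDistortion δ₁) (hδ₂ : IsNormalDistortion δ₂) {d₁ d₂ r : ℝ}
    (hr : Achievable q δ₁ δ₂ d₁ d₂ r) : cutSetBound q δ₁ δ₂ d₁ d₂ ≤ r := by
  obtain ⟨x, y⟩ : Nonempty (X × Y) := by
    by_contra h
    rw [not_nonempty_iff] at h
    simpa using hq.2
  have : Nonempty Xh := ⟨(hδ₁.normal x).choose⟩
  have : Nonempty Yh := ⟨(hδ₂.normal y).choose⟩
  refine max_le (condRD_le_of_codes hq fun ε hε => ?_)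
    (condRD_le_of_codes (swap_mem_stdSimplex hq) fun ε hε => ?_)
  · obtain ⟨n, hn, c, hc, hc₁, -⟩ := hr.2 ε hε 0
    exact ⟨n, hn, c.M, c.enc, c.dec₁, hc, hc₁⟩
  · obtain ⟨n, hn, c, hc, -, hc₂⟩ := hr.2 ε hε 0
    refine ⟨n, hn, c.M, fun y x => c.enc x y, c.dec₂, hc, ?_⟩
    rw [sum_comm]
    exact hc₂

end RelayRD

end

theorem mainTheorem8 {X Y Xh Yh : Type*} [Fintype X] [Fintype Y] [Fintype Xh] [Fintype Yh]
    (q : X × Y → ℝ) (hq : q ∈ stdSimplex ℝ (X × Y))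
    (δ₁ : X → Xh → ℝ) (δ₂ : Y → Yh → ℝ)
    (hδ₁ : RelayRD.IsNormalDistortion δ₁) (hδ₂ : RelayRD.IsNormalDistortion δ₂)
    (d₁ d₂ : ℝ) (hd₁ : 0 ≤ d₁) (hd₂ : 0 ≤ d₂) :
    (RelayRD.cutSetBound q δ₁ δ₂ d₁ d₂ ≤ RelayRD.rdFunction q δ₁ δ₂ d₁ d₂ ∧
      RelayRD.rdFunction q δ₁ δ₂ d₁ d₂ ≤ RelayRD.compressLinearBound q δ₁ δ₂ d₁ d₂) ∧
    (∀ (lx ly : ℕ) [NeZero lx] [NeZero ly] (ρ₁ : ZMod lx → ℝ) (ρ₂ : ZMod ly → ℝ),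
      RelayRD.IsDifferenceDistortion δ₁ lx ρ₁ → RelayRD.IsDifferenceDistortion δ₂ ly ρ₂ →
      (RelayRD.compressLinearBound q δ₁ δ₂ d₁ d₂ - RelayRD.cutSetBound q δ₁ δ₂ d₁ d₂ ≤
        max (RelayRD.minimaxCapacity ρ₁ (fun z => ρ₁ (-z)) d₁)
          (RelayRD.minimaxCapacity ρ₂ (fun z => ρ₂ (-z)) d₂)) ∧
      ((∀ z, ρ₁ (-z) = ρ₁ z) → (∀ z, ρ₂ (-z) = ρ₂ z) →
        RelayRD.compressLinearBound q δ₁ δ₂ d₁ d₂ - RelayRD.cutSetBound q δ₁ δ₂ d₁ d₂ ≤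
          max (RelayRD.minimaxCapacity ρ₁ ρ₁ d₁) (RelayRD.minimaxCapacity ρ₂ ρ₂ d₂))) := by
  have hach := RelayRD.achievable_compressLinearBound hq hδ₁ hδ₂ hd₁ hd₂
  have hdiff : ∀ (lx ly : ℕ) [NeZero lx] [NeZero ly] (ρ₁ : ZMod lx → ℝ) (ρ₂ : ZMod ly → ℝ),
      RelayRD.IsDifferenceDistortion δ₁ lx ρ₁ → RelayRD.IsDifferenceDistortion δ₂ ly ρ₂ →
      RelayRD.compressLinearBound q δ₁ δ₂ d₁ d₂ - RelayRD.cutSetBound q δ₁ δ₂ d₁ d₂ ≤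
        max (RelayRD.minimaxCapacity ρ₁ (fun z => ρ₁ (-z)) d₁)
          (RelayRD.minimaxCapacity ρ₂ (fun z => ρ₂ (-z)) d₂) := by
    intro lx ly _ _ ρ₁ ρ₂ hρ₁ hρ₂
    have h₁ := RelayRD.wzRD_sub_condRD_le_minimaxCapacity hq hδ₁ hd₁ hρ₁
    have h₂ := RelayRD.wzRD_sub_condRD_le_minimaxCapacity (RelayRD.swap_mem_stdSimplex hq)
      hδ₂ hd₂ hρ₂
    -- A difference of maxima is at most the maximum of the differences, so the two rate losses are
    -- bounded separately.
    exact (max_sub_max_le_max _ _ _ _).trans (max_le_max h₁ h₂)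
  refine ⟨⟨?_, ?_⟩, fun lx ly _ _ ρ₁ ρ₂ hρ₁ hρ₂ =>
    ⟨hdiff lx ly ρ₁ ρ₂ hρ₁ hρ₂, fun hs₁ hs₂ => ?_⟩⟩
  -- Achievability is needed here too: it shows that the set of achievable rates is nonempty.
  · exact le_csInf ⟨_, hach⟩ fun r hr => RelayRD.cutSetBound_le_of_achievable hq hδ₁ hδ₂ hr
  · exact csInf_le ⟨0, fun r hr => hr.1⟩ hach
  · simpa only [hs₁, hs₂] using hdiff lx ly ρ₁ ρ₂ hρ₁ hρ₂
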